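/- For a lattice $\mathcal L\subset\mathbb R^n$ (the integer span of a basis of $\mathbb R^n$), $\vec t\in\mathbb R^n$ and $s>0$, let $\rho_s(\vec x)=\exp(-\pi\|\vec x\|^2/s^2)$ and $\rho_s(\mathcal L-\vec t)=\sum_{\vec y\in\mathcal L}\rho_s(\vec y-\vec t)$, and let $D_{\mathcal L-\vec t,s}$ be the probability distribution on $\mathcal L-\vec t$ that gives $\vec y-\vec t$ probability $\rho_s(\vec y-\vec t)/\rho_s(\mathcal L-\vec t)$. *Pair-and-average* goes through a list of vectors of $\mathcal L-\vec t$: whenever some later, still unpaired vector is congruent modulo $2\mathcal L$ to the current unpaired vector, it pairs the current vector with the first such one and outputs the average of the two; a vector without partner is dropped. A random finite list $(\vec X_1,\dots,\vec X_m)$ of vectors of $\mathcal L-\vec t$ ($m$ may be random) is a *mixture of independent Gaussians over $\mathcal L-\vec t$ with parameter $s$* if, conditioned on any list of cosets $2\mathcal L+\vec c_1,\dots,2\mathcal L+\vec c_m$ of positive probability for $(2\mathcal L+\vec X_1,\dots,2\mathcal L+\vec X_m)$, the $\vec X_i$ are independent with $\vec X_i\sim D_{2\mathcal L+\vec c_i,s}$.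 A mixture $\mathcal M$ *dominates* a mixture $\mathcal M'$ if for all multiplicities $k_{\vec c}\in\mathbb N$, indexed by the cosets $\vec c$ of $2\mathcal L$ in $\mathcal L-\vec t$, the probability that for every $\vec c$ at least $k_{\vec c}$ entries lie in $\vec c$ is at least as large for $\mathcal M$ as for $\mathcal M'$. $\mathcal M$ dominates $\mathcal M'$ *up to statistical distance $\varepsilon$* if $\mathcal M$ dominates some mixture (with the same lattice, shift and parameter) within statistical distance $\varepsilon$ of $\mathcal M'$, and some such mixture within statistical distance $\varepsilon$ of $\mathcal M$ dominates $\mathcal M'$. **Theorem.** There are universal constants $C,c>0$ such that the following holds for every $n$, every lattice $\mathcal L\subset\mathbb R^n$, shift $\vec t\in\mathbb R^n$, parameter $s>0$, integer $M\ge2$ and real $\kappa\ge C\log M$ with $$M\ \ge\ 10\kappa^2\cdot\frac{\rho_s(\mathcal L-\vec t)}{\max_{\vec c\in\mathcal L/(2\mathcal L)}\rho_s(2\mathcal L+\vec c-\vec t)} .$$ If $\vec X_1,\dots,\vec X_M$ are independent samples from $D_{\mathcal L-\vec t,s}$, then the output of pair-and-average on $(\vec X_1,\dots,\vec X_M)$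 is a mixture of independent Gaussians over $\mathcal L-\vec t$ with parameter $s/\sqrt2$ which, up to statistical distance $\exp(-c\kappa)$, dominates $$M'=\left\lceil\frac{M}{32\kappa}\cdot\frac{\rho_{s/\sqrt2}(\mathcal L-\vec t)\,\rho_{s/\sqrt2}(\mathcal L)}{\rho_s(\mathcal L-\vec t)\cdot\max_{\vec d\in\mathcal L/(2\mathcal L)}\rho_s(2\mathcal L+\vec d-\vec t)}\right\rceil$$ independent samples from $D_{\mathcal L-\vec t,s/\sqrt2}$. -/

import Mathlib

open scoped ENNReal

noncomputable section

namespace PairAverage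

/-! ### Random lists -/

/-- Independent sampling, one entry from each of the given distributions, in order. -/
def indepList {α : Type} : List (PMF α) → PMF (List α)
  | [] => PMF.pure []
  | p :: ps => p.bind fun a => (indepList ps).bind fun l => PMF.pure (a :: l)

/-- `M` independent samples from `p`. -/
def iidList {α : Type} (p : PMF α) (M : ℕ) : PMF (List α) :=
  indepList (List.replicate M p)

/-- The probability of an event. -/
def prob {α : Type} (μ : PMF α) (A : Set α) : ℝ≥0∞ := μ.toOuterMeasure A

/-- Statistical (total variation) distance: the supremum of `|μ(A) - ν(A)|` over all events. -/
def statDist {α : Type} (μ ν : PMF α) : ℝ :=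
  ⨆ A : Set α, |(prob μ A).toReal - (prob ν A).toReal|

open Classical in
/-- `μ` dominates `ν`: for all prescribed multiplicities `k`, a list drawn from `μ` is at least as
likely to contain every `i` at least `k i` times as a list drawn from `ν`. -/
def Dominates {S : Type} (μ ν : PMF (List S)) : Prop :=
  ∀ k : S → ℕ, prob ν {l | ∀ i, k i ≤ l.count i} ≤ prob μ {l | ∀ i, k i ≤ l.count i}

variable {n : ℕ}

/-! ### Gaussian mass and the discrete Gaussian -/

/-- `ρ_s(x) = exp(-π ‖x‖² / s²)`. -/
def gaussianMass (s : ℝ) (x : EuclideanSpace ℝ (Fin n)) : ℝ :=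
  Real.exp (-Real.pi * ‖x‖ ^ 2 / s ^ 2)

/-- `ρ_s(L - t) = ∑_{y ∈ L} ρ_s(y - t)`. -/
def latticeMass (s : ℝ) (L : Submodule ℤ (EuclideanSpace ℝ (Fin n)))
    (t : EuclideanSpace ℝ (Fin n)) : ℝ :=
  ∑' y : L, gaussianMass s ((y : EuclideanSpace ℝ (Fin n)) - t)

theorem gaussianMass_summable {s : ℝ} (hs : 0 < s) (L : Submodule ℤ (EuclideanSpace ℝ (Fin n)))
    [DiscreteTopology L] (t : EuclideanSpace ℝ (Fin n)) :
    Summable fun y : L => gaussianMass s ((y : EuclideanSpace ℝ (Fin n)) - t) := by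
  set m : ℕ := Module.finrank ℤ L + 1 with hm
  have ha : 0 < Real.pi / s ^ 2 := by positivity
  have h := (ZLattice.summable_norm_sub_inv_pow L (2 * m) (by omega) t).mul_left
    ((m.factorial : ℝ) / (Real.pi / s ^ 2) ^ m)
  refine Summable.of_norm_bounded_eventually h ?_
  have hfin : {y : L | (y : EuclideanSpace ℝ (Fin n)) = t}.Finite := by
    apply Set.Subsingleton.finite
    intro a ha b hb
    exact Subtype.ext (ha.trans hb.symm)
  filter_upwards [hfin.compl_mem_cofinite] with y hy
  have hr : 0 < ‖(y : EuclideanSpace ℝ (Fin n)) - t‖ := norm_pos_iff.mpr (sub_ne_zero.mpr hy)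
  set r := ‖(y : EuclideanSpace ℝ (Fin n)) - t‖ with hrdef
  have hx : 0 < Real.pi / s ^ 2 * r ^ 2 := by positivity
  have key := Real.pow_div_factorial_le_exp _ hx.le m
  have hpos : 0 < (Real.pi / s ^ 2 * r ^ 2) ^ m / (m.factorial : ℝ) := by positivity
  rw [gaussianMass, Real.norm_eq_abs, Real.abs_exp,
    show -Real.pi * r ^ 2 / s ^ 2 = -(Real.pi / s ^ 2 * r ^ 2) by ring, Real.exp_neg]
  refine (inv_anti₀ hpos key).trans (le_of_eq ?_)
  rw [inv_div, mul_pow, ← pow_mul, inv_pow]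
  field_simp

/-- The discrete Gaussian distribution `D_{L - t, s}`: the vector `y - t`, `y ∈ L`, has probability
`ρ_s(y - t) / ρ_s(L - t)`. -/
def discreteGaussian {s : ℝ} (hs : 0 < s) (L : Submodule ℤ (EuclideanSpace ℝ (Fin n)))
    [DiscreteTopology L] (t : EuclideanSpace ℝ (Fin n)) : PMF (EuclideanSpace ℝ (Fin n)) :=
  PMF.map (fun y : L => (y : EuclideanSpace ℝ (Fin n)) - t)
    (PMF.normalize
      (fun y : L => ENNReal.ofReal (gaussianMass s ((y : EuclideanSpace ℝ (Fin n)) - t)))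
      (by
        intro h
        have h0 := ENNReal.tsum_eq_zero.mp h 0
        exact absurd (ENNReal.ofReal_eq_zero.mp h0) (not_le.mpr (Real.exp_pos _)))
      (gaussianMass_summable hs L t).tsum_ofReal_ne_top)

/-! ### Cosets modulo `2L` -/

/-- The lattice `2L`. -/
def twice (L : Submodule ℤ (EuclideanSpace ℝ (Fin n))) :
    Submodule ℤ (EuclideanSpace ℝ (Fin n)) :=
  L.map (LinearMap.lsmul ℤ (EuclideanSpace ℝ (Fin n)) 2)

theorem twice_le (L : Submodule ℤ (EuclideanSpace ℝ (Fin n))) : twice L ≤ L := by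
  rintro _ ⟨y, hy, rfl⟩
  exact L.smul_mem 2 hy

instance (L : Submodule ℤ (EuclideanSpace ℝ (Fin n))) [DiscreteTopology L] :
    DiscreteTopology (twice L) :=
  DiscreteTopology.of_subset (s := (L : Set (EuclideanSpace ℝ (Fin n))))
    (inferInstanceAs (DiscreteTopology L)) (twice_le L)

/-- The coset `2L + x` of a vector `x`. -/
def coset (L : Submodule ℤ (EuclideanSpace ℝ (Fin n))) (x : EuclideanSpace ℝ (Fin n)) :
    EuclideanSpace ℝ (Fin n) ⧸ twice L :=
  Submodule.Quotient.mk x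

/-- `max_{c ∈ L/2L} ρ_s(2L + c - t)`, each coset being given by a representative `c ∈ L`. -/
def maxCosetMass (s : ℝ) (L : Submodule ℤ (EuclideanSpace ℝ (Fin n)))
    (t : EuclideanSpace ℝ (Fin n)) : ℝ :=
  ⨆ c : L, latticeMass s (twice L) (t - (c : EuclideanSpace ℝ (Fin n)))

/-! ### Mixtures of independent Gaussians -/

/-- The coset distribution `(2L + X₁, …, 2L + X_M)` of a random list `(X₁, …, X_M)`. -/
def cosetDist (L : Submodule ℤ (EuclideanSpace ℝ (Fin n)))
    (μ : PMF (List (EuclideanSpace ℝ (Fin n)))) :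
    PMF (List (EuclideanSpace ℝ (Fin n) ⧸ twice L)) :=
  μ.map (List.map (coset L))

/-- A random list of vectors of `L - t` is a mixture of independent Gaussians over `L - t` with
parameter `s` if, for every list of cosets `2L + c₁, …, 2L + c_M` (with `cᵢ ∈ L - t`) that occurs
with positive probability, conditioned on the list having exactly these cosets, its entries are
independent, the `i`-th one with distribution `D_{2L + cᵢ, s}`. -/
structure IsGaussianMixture {s : ℝ} (hs : 0 < s) (L : Submodule ℤ (EuclideanSpace ℝ (Fin n)))
    [DiscreteTopology L] (t : EuclideanSpace ℝ (Fin n))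
    (μ : PMF (List (EuclideanSpace ℝ (Fin n)))) : Prop where
  mem_shift : ∀ l ∈ μ.support, ∀ x ∈ l, x + t ∈ L
  cond_eq : ∀ cs : List (EuclideanSpace ℝ (Fin n)), (∀ c ∈ cs, c + t ∈ L) →
    ∀ h : ∃ l ∈ {l : List (EuclideanSpace ℝ (Fin n)) | l.map (coset L) = cs.map (coset L)},
      l ∈ μ.support,
    μ.filter {l | l.map (coset L) = cs.map (coset L)} h =
      indepList (cs.map fun c => discreteGaussian hs (twice L) (-c))

/-- Domination between mixtures of Gaussians: domination of the coset distributions. -/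
def MixtureDominates (L : Submodule ℤ (EuclideanSpace ℝ (Fin n)))
    (μ ν : PMF (List (EuclideanSpace ℝ (Fin n)))) : Prop :=
  Dominates (cosetDist L μ) (cosetDist L ν)

/-- `μ` dominates `ν` up to statistical distance `ε`: either of the two can be replaced by a mixture
of independent Gaussians within statistical distance `ε` so that domination holds exactly. -/
def MixtureDominatesUpTo {s : ℝ} (hs : 0 < s) (L : Submodule ℤ (EuclideanSpace ℝ (Fin n)))
    [DiscreteTopology L] (t : EuclideanSpace ℝ (Fin n)) (ε : ℝ)
    (μ ν : PMF (List (EuclideanSpace ℝ (Fin n)))) : Prop :=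
  (∃ ν' : PMF (List (EuclideanSpace ℝ (Fin n))), IsGaussianMixture hs L t ν' ∧
    statDist ν' ν ≤ ε ∧ MixtureDominates L μ ν') ∧
  (∃ μ' : PMF (List (EuclideanSpace ℝ (Fin n))), IsGaussianMixture hs L t μ' ∧
    statDist μ' μ ≤ ε ∧ MixtureDominates L μ' ν)

/-! ### The procedure -/

open Classical in
/-- Pair and average: go through the list; if some later, still unpaired vector is congruent to the
current vector modulo `2L`, pair the current vector with the first such one, remove both, and output
their average; otherwise drop the current vector. -/
def pairAndAverage (L : Submodule ℤ (EuclideanSpace ℝ (Fin n))) :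
    List (EuclideanSpace ℝ (Fin n)) → List (EuclideanSpace ℝ (Fin n))
  | [] => []
  | x :: xs =>
    match xs.find? (fun y => decide (coset L y = coset L x)) with
    | none => pairAndAverage L xs
    | some y =>
      (1 / 2 : ℝ) • (x + y) ::
        pairAndAverage L (xs.eraseP (fun y => decide (coset L y = coset L x)))
  termination_by l => l.length
  decreasing_by
  · simp
  · exact Nat.lt_succ_of_le List.length_eraseP_le

/-- The output of pair and average on `M` independent samples from `D_{L - t, s}`. -/
def pairAndAverageGaussian {s : ℝ} (hs : 0 < s) (L : Submodule ℤ (EuclideanSpace ℝ (Fin n)))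
    [DiscreteTopology L] (t : EuclideanSpace ℝ (Fin n)) (M : ℕ) :
    PMF (List (EuclideanSpace ℝ (Fin n))) :=
  (iidList (discreteGaussian hs L t) M).map (pairAndAverage L)

/-- `M' = ⌈ M/(32κ) · ρ_{s/√2}(L - t) ρ_{s/√2}(L) / (ρ_s(L - t) max_d ρ_s(2L + d - t)) ⌉`. -/
def outputCount (s : ℝ) (L : Submodule ℤ (EuclideanSpace ℝ (Fin n)))
    (t : EuclideanSpace ℝ (Fin n)) (M : ℕ) (κ : ℝ) : ℕ :=
  ⌈(M : ℝ) / (32 * κ) *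
    (latticeMass (s / √2) L t * latticeMass (s / √2) L 0 /
      (latticeMass s L t * maxCosetMass s L t))⌉₊

theorem div_sqrt_two_pos {s : ℝ} (hs : 0 < s) : 0 < s / √2 := by positivity

end PairAverage

end

noncomputable section

namespace PairAverage

/-! ### Events, couplings and independent lists -/

section PMFLemmas

variable {α β γ : Type}

/-! The argument separates the cosets of 2L from the positions inside them. A sample from D_{L-t,s}
is a coset c drawn with probability p(c) = ρ_s(c)/ρ_s(L-t), followed by a Gaussian on c
(`discreteGaussian_eq_bind`). Which vectors get paired depends on the cosets only. So, given the
cosets, the output consists of independent averages, ⌊N_c/2⌋ of them coming from c if c occurs N_c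
times (`map_pairAndAverage`, `count_pairs`).

By the parallelogram law, ρ_s(z+d) ρ_s(z-d) = ρ_{s/√2}(z) ρ_{s/√2}(d). Hence the average z of two
Gaussians on c has density ρ_{s/√2}(z) times a factor that depends only on z mod 2L
(`averageLaw_apply`), which makes the output a mixture with parameter s/√2. If c is itself drawn
from w proportional to p², these factors add up to a constant and the average is exactly
D_{L-t,s/√2} (`squareLaw_bind`). The M' target samples therefore come from the same averaging kernel
applied to M' cosets drawn from w. It remains to couple the two coset lists so that, outside an
event of probability exp(-κ/32), every c occurs at most ⌊N_c/2⌋ times in the second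
(`exists_pairs_coupling`, `mixtureDominatesUpTo_of_coupling`).

Poissonization (`exists_sample_coupling`) replaces the sizes M and M' by Poisson variables of means
M/2 and 2M'. The multiplicities become independent Poisson variables of means a = M p(c)/2 and b =
2M' w(c), which can be coupled coset by coset through quantiles (`exists_poissonLaw_coupling`). The
size of M' and the lower bound on M give b ≤ a/(4κ) and b ≤ a²/(20κ³). The first settles large a by
concentration; the second settles small a, where two hits, of probability about a², must outweigh
one hit, of probability about b. The failure bound (2a+b)e^{-κ/16} is linear in the means, so its
sum over all cosets is (M+2M')e^{-κ/16}, whatever the number of cosets, and κ ≥ 100 log M absorbs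
the factor M. -/

theorem prob_bind (μ : PMF α) (f : α → PMF β) (A : Set β) :
    prob (μ.bind f) A = ∑' a, μ a * prob (f a) A :=
  PMF.toOuterMeasure_bind_apply _ _ _

theorem prob_map (μ : PMF α) (f : α → β) (A : Set β) : prob (μ.map f) A = prob μ (f ⁻¹' A) :=
  PMF.toOuterMeasure_map_apply _ _ _

theorem prob_mono (μ : PMF α) {A B : Set α} (h : A ⊆ B) : prob μ A ≤ prob μ B :=
  MeasureTheory.measure_mono h

theorem prob_le_one (μ : PMF α) (A : Set α) : prob μ A ≤ 1 := by
  rw [prob, PMF.toOuterMeasure_apply, ← μ.tsum_coe]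
  exact ENNReal.tsum_le_tsum fun a => Set.indicator_le_self _ _ _

theorem prob_ne_top (μ : PMF α) (A : Set α) : prob μ A ≠ ∞ :=
  ne_top_of_le_ne_top ENNReal.one_ne_top (prob_le_one μ A)

theorem prob_union_le (μ : PMF α) (A B : Set α) : prob μ (A ∪ B) ≤ prob μ A + prob μ B :=
  MeasureTheory.measure_union_le A B

theorem prob_compl (μ : PMF α) (A : Set α) : prob μ A + prob μ Aᶜ = 1 := by
  rw [prob, prob, PMF.toOuterMeasure_apply, PMF.toOuterMeasure_apply, ← ENNReal.tsum_add,
    ← μ.tsum_coe]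
  exact tsum_congr fun a => Set.indicator_self_add_compl_apply A μ a

theorem prob_eq_zero_of_forall {μ : PMF α} {A : Set α} (h : ∀ a ∈ μ.support, a ∉ A) :
    prob μ A = 0 :=
  (PMF.toOuterMeasure_apply_eq_zero_iff _ _).2 (Set.disjoint_left.2 h)

theorem bind_congr_support {μ : PMF α} {f g : α → PMF β} (h : ∀ a ∈ μ.support, f a = g a) :
    μ.bind f = μ.bind g := by
  ext b
  rw [PMF.bind_apply, PMF.bind_apply]
  refine tsum_congr fun a => ?_
  by_cases ha : a ∈ μ.support
  · rw [h a ha]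
  · rw [(PMF.apply_eq_zero_iff _ _).2 ha, zero_mul, zero_mul]

/-- Two kernels that agree off an event `B` give mixtures within distance `μ(B)`. -/
theorem prob_bind_le_add (μ : PMF α) (f g : α → PMF β) (B : Set α) (h : ∀ a ∉ B, f a = g a)
    (A : Set β) : prob (μ.bind f) A ≤ prob (μ.bind g) A + prob μ B := by
  rw [prob_bind, prob_bind, show prob μ B = _ from PMF.toOuterMeasure_apply _ _,
    ← ENNReal.tsum_add]
  refine ENNReal.tsum_le_tsum fun a => ?_
  by_cases ha : a ∈ B
  · rw [Set.indicator_of_mem ha]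
    exact (mul_le_of_le_one_right' (prob_le_one _ _)).trans le_add_self
  · rw [h a ha]
    exact le_self_add

theorem statDist_bind_le (μ : PMF α) (f g : α → PMF β) (B : Set α) (h : ∀ a ∉ B, f a = g a)
    {ε : ℝ} (hε : 0 ≤ ε) (hB : prob μ B ≤ ENNReal.ofReal ε) :
    statDist (μ.bind f) (μ.bind g) ≤ ε := by
  have key : ∀ (f g : α → PMF β), (∀ a ∉ B, f a = g a) → ∀ A : Set β,
      (prob (μ.bind f) A).toReal ≤ (prob (μ.bind g) A).toReal + ε := by
    intro f g h A
    rw [← ENNReal.toReal_ofReal hε, ← ENNReal.toReal_add (prob_ne_top _ _) ENNReal.ofReal_ne_top]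
    refine ENNReal.toReal_mono (by finiteness [prob_ne_top (μ.bind g) A]) ?_
    exact (prob_bind_le_add μ f g B h A).trans (by gcongr)
  refine ciSup_le fun A => ?_
  rw [abs_le]
  constructor
  · linarith [key g f (fun a ha => (h a ha).symm) A]
  · linarith [key f g h A]

/-- Every joint law is the law of its second coordinate followed by a kernel. -/
theorem exists_disintegration (μ : PMF (α × β)) :
    ∃ k : β → PMF α, μ = (μ.map Prod.snd).bind fun b => (k b).map fun a => (a, b) := by
  classical
  obtain ⟨x₀, -⟩ := μ.support_nonempty
  -- The kernel is the conditional law of the first coordinate; where b has no mass, an arbitrary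
  -- default is used.
  refine ⟨fun b => if h : ∃ x ∈ Prod.snd ⁻¹' {b}, x ∈ μ.support then
    (μ.filter _ h).map Prod.fst else PMF.pure x₀.1, ?_⟩
  ext ⟨a, b⟩
  rw [PMF.bind_apply, tsum_eq_single b]
  · have hb : (μ.map Prod.snd) b = ∑' x, (Prod.snd ⁻¹' {b}).indicator μ x := by
      rw [← PMF.toOuterMeasure_apply_singleton (μ.map Prod.snd) b,
        PMF.toOuterMeasure_map_apply, PMF.toOuterMeasure_apply]
    rw [hb]
    by_cases h : ∃ x ∈ Prod.snd ⁻¹' {b}, x ∈ μ.support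
    · beta_reduce
      rw [dif_pos h, PMF.map_comp]
      have hf : ((μ.filter _ h).map ((fun a => (a, b)) ∘ Prod.fst)) (a, b)
          = μ.filter _ h (a, b) := by
        rw [PMF.map_apply, tsum_eq_single (a, b)]
        · rw [if_pos (by simp)]
        · rintro ⟨a', b'⟩ hne
          by_cases hb' : b' = b
          · subst hb'
            rw [if_neg]
            rintro h
            simp only [Function.comp, Prod.mk.injEq] at h
            exact hne (by simp [h.1])
          · rw [PMF.filter_apply_eq_zero_of_notMem _ (by simpa using hb')]
            simp
      have h0 : ∑' x, (Prod.snd ⁻¹' {b}).indicator μ x ≠ 0 := by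
        obtain ⟨x, hx, hx'⟩ := h
        intro h0
        have := ENNReal.tsum_eq_zero.1 h0 x
        rw [Set.indicator_of_mem hx] at this
        exact hx' this
      have h1 : ∑' x, (Prod.snd ⁻¹' {b}).indicator μ x ≠ ∞ := μ.tsum_coe_indicator_ne_top _
      rw [hf, PMF.filter_apply, Set.indicator_of_mem (by simp), mul_comm, mul_assoc,
        ENNReal.inv_mul_cancel h0 h1, mul_one]
    · push Not at h
      have : ∀ x, (Prod.snd ⁻¹' {b}).indicator μ x = 0 := by
        intro x
        by_cases hx : x ∈ Prod.snd ⁻¹' {b}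
        · rw [Set.indicator_of_mem hx]
          exact (PMF.apply_eq_zero_iff _ _).2 (h x hx)
        · rw [Set.indicator_of_notMem hx]
      simp only [this, tsum_zero, zero_mul]
      exact (PMF.apply_eq_zero_iff _ _).2 (h (a, b) rfl)
  · intro b' hb'
    convert mul_zero _
    rw [PMF.apply_eq_zero_iff, PMF.mem_support_map_iff]
    rintro ⟨x, -, hx⟩
    exact hb' (Prod.ext_iff.1 hx).2

/-- Two joint laws can be glued along a coupling of their second marginals. -/
theorem exists_gluing {δ : Type} (μ : PMF (α × β)) (ν : PMF (γ × δ)) (π : PMF (β × δ))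
    (hμ : π.map Prod.fst = μ.map Prod.snd) (hν : π.map Prod.snd = ν.map Prod.snd) :
    ∃ Γ : PMF ((α × β) × (γ × δ)), Γ.map Prod.fst = μ ∧ Γ.map Prod.snd = ν ∧
      Γ.map (fun x => (x.1.2, x.2.2)) = π := by
  obtain ⟨k, hk⟩ := exists_disintegration μ
  obtain ⟨k', hk'⟩ := exists_disintegration ν
  -- Given the coupled pair, the two first coordinates are drawn independently from their
  -- conditional laws.
  refine ⟨π.bind fun y => (k y.1).bind fun a => (k' y.2).map fun c => ((a, y.1), (c, y.2)),
    ?_, ?_, ?_⟩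
  · conv_rhs => rw [hk, ← hμ, PMF.bind_map]
    simp only [PMF.map_bind, PMF.map_comp, Function.comp_def]
    congr 1; funext y
    rw [← PMF.bind_pure_comp]
    congr 1; funext a
    exact PMF.map_const _ _
  · conv_rhs => rw [hk', ← hν, PMF.bind_map]
    simp only [PMF.map_bind, PMF.map_comp, Function.comp_def, PMF.bind_const]
  · simp only [PMF.map_bind, PMF.map_comp, Function.comp_def]
    conv_rhs => rw [← PMF.bind_pure π]
    congr 1; funext y
    rw [← PMF.bind_const (k y.1) (PMF.pure y)]
    congr 1; funext a
    exact PMF.map_const _ _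

end PMFLemmas

/-! ### Independent lists -/

section IndepList

variable {α β : Type}

theorem indepList_nil : indepList ([] : List (PMF α)) = PMF.pure [] := rfl

theorem indepList_cons (p : PMF α) (ps : List (PMF α)) :
    indepList (p :: ps) = p.bind fun a => (indepList ps).map (List.cons a) := rfl

theorem map_indepList (f : α → β) (ps : List (PMF α)) :
    (indepList ps).map (List.map f) = indepList (ps.map (PMF.map f)) := by
  induction ps with
  | nil => simp [indepList_nil, PMF.pure_map]
  | cons p ps ih =>
    rw [List.map_cons, indepList_cons, indepList_cons, ← ih, PMF.map_bind, PMF.bind_map]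
    simp only [PMF.map_comp, Function.comp_def, List.map_cons]

/-- This allows all cosets to be drawn before any vector inside them. -/
theorem indepList_bind {ι : Type} (K : ι → PMF α) (D : α → PMF β) (cs : List ι) :
    indepList (cs.map fun c => (K c).bind D) =
      (indepList (cs.map K)).bind fun es => indepList (es.map D) := by
  induction cs with
  | nil => simp [indepList_nil, PMF.pure_bind]
  | cons c cs ih =>
    rw [List.map_cons, List.map_cons, indepList_cons, indepList_cons, ih, PMF.bind_bind,
      PMF.bind_bind]
    congr 1; funext e
    simp only [PMF.bind_map, Function.comp_def, List.map_cons, indepList_cons, PMF.map_bind]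
    rw [PMF.bind_comm]

theorem iidList_succ (p : PMF α) (m : ℕ) :
    iidList p (m + 1) = p.bind fun a => (iidList p m).map (List.cons a) := rfl

theorem iidList_zero (p : PMF α) : iidList p 0 = PMF.pure [] := rfl

theorem iidList_bind (p : PMF α) (D : α → PMF β) (m : ℕ) :
    iidList (p.bind D) m = (iidList p m).bind fun es => indepList (es.map D) := by
  have h := indepList_bind (fun _ : Unit => p) D (List.replicate m ())
  simpa [iidList, List.map_replicate] using h

theorem indepList_append (ps qs : List (PMF α)) :
    indepList (ps ++ qs) = (indepList ps).bind fun l => (indepList qs).map (l ++ ·) := by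
  induction ps with
  | nil =>
    rw [indepList_nil, PMF.pure_bind]
    exact (PMF.map_id _).symm
  | cons p ps ih =>
    rw [List.cons_append, indepList_cons, indepList_cons, ih, PMF.bind_bind]
    congr 1; funext e
    simp only [PMF.bind_map, Function.comp_def, PMF.map_bind, PMF.map_comp, List.cons_append]

theorem iidList_add (p : PMF α) (m k : ℕ) :
    iidList p (m + k) = (iidList p m).bind fun l => (iidList p k).map (l ++ ·) := by
  rw [iidList, List.replicate_add, indepList_append]; rfl

theorem length_of_mem_support_indepList {ps : List (PMF α)} {l : List α}
    (h : l ∈ (indepList ps).support) : l.length = ps.length := by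
  induction ps generalizing l with
  | nil => simp_all [indepList_nil]
  | cons p ps ih =>
    rw [indepList_cons, PMF.mem_support_bind_iff] at h
    obtain ⟨a, -, h⟩ := h
    obtain ⟨l', h', rfl⟩ := (PMF.mem_support_map_iff _ _ _).1 h
    simp [ih h']

theorem length_of_mem_support_iidList {p : PMF α} {m : ℕ} {l : List α}
    (h : l ∈ (iidList p m).support) : l.length = m := by
  simpa using length_of_mem_support_indepList h

theorem iidList_map_take (p : PMF α) (m j : ℕ) :
    (iidList p m).map (List.take j) = iidList p (min j m) := by
  rcases le_total m j with h | h
  · rw [min_eq_right h, ← PMF.bind_pure_comp, bind_congr_support (g := PMF.pure), PMF.bind_pure]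
    intro l hl
    simp [List.take_of_length_le ((length_of_mem_support_iidList hl).le.trans h)]
  · rw [min_eq_left h]
    obtain ⟨k, rfl⟩ := Nat.exists_eq_add_of_le h
    rw [iidList_add, PMF.map_bind]
    conv_rhs => rw [← PMF.bind_pure (iidList p j)]
    refine bind_congr_support fun l hl => ?_
    rw [PMF.map_comp, ← PMF.map_const (iidList p k) l]
    congr 1; funext l'
    simp [List.take_left' (length_of_mem_support_iidList hl)]

end IndepList

/-! ### Domination of random lists -/

section Domination

variable {S : Type}

theorem Dominates.refl (μ : PMF (List S)) : Dominates μ μ := fun _ => le_rfl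

theorem Dominates.trans {μ ν ξ : PMF (List S)} (h : Dominates μ ν) (h' : Dominates ν ξ) :
    Dominates μ ξ := fun k => (h' k).trans (h k)

theorem Dominates.bind {ι : Type} {γ : PMF ι} {f g : ι → PMF (List S)}
    (h : ∀ i, Dominates (f i) (g i)) : Dominates (γ.bind f) (γ.bind g) := by
  intro k
  rw [prob_bind, prob_bind]
  exact ENNReal.tsum_le_tsum fun i => by gcongr; exact h i k

open Classical in
theorem Dominates.map_cons {μ ν : PMF (List S)} (h : Dominates μ ν) (a : S) :
    Dominates (μ.map (List.cons a)) (ν.map (List.cons a)) := by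
  intro k
  rw [prob_map, prob_map]
  -- The new entry `a` lowers the demand at `a` by one, truncated at zero.
  convert h (fun i => k i - if a = i then 1 else 0) using 3 <;>
  · simp only [Set.preimage_ofPred_eq, List.count_cons, beq_iff_eq, tsub_le_iff_right]

open Classical in
theorem Dominates.of_map_cons (μ : PMF (List S)) (a : S) :
    Dominates (μ.map (List.cons a)) μ := by
  intro k
  rw [prob_map]
  refine prob_mono _ fun l hl i => (hl i).trans ?_
  exact List.count_le_count_cons

open Classical in
theorem Dominates.of_perm_map {ι : Type} (μ : PMF ι) (f g : ι → List S)
    (h : ∀ i, (f i).Perm (g i)) : Dominates (μ.map f) (μ.map g) := by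
  intro k
  rw [prob_map, prob_map]
  refine prob_mono _ fun l hl i => (hl i).trans ?_
  exact ((h l).count_eq i).ge

/-- The two list laws may differ, but domination reads only multiplicities and independent draws
commute. -/
theorem dominates_indepList_of_perm {ps qs : List (PMF S)} (h : ps.Perm qs) :
    Dominates (indepList ps) (indepList qs) := by
  induction h with
  | nil => exact .refl _
  | cons p _ ih => exact .bind fun a => ih.map_cons a
  | swap p q l =>
    simp only [indepList_cons, PMF.map_bind, PMF.map_comp]
    rw [PMF.bind_comm]
    exact .bind fun a => .bind fun b => .of_perm_map _ _ _ fun l => .swap _ _ _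
  | trans _ _ ih ih' => exact ih.trans ih'

theorem dominates_indepList_of_sublist {ps qs : List (PMF S)} (h : ps.Sublist qs) :
    Dominates (indepList qs) (indepList ps) := by
  induction h with
  | slnil => exact .refl _
  | cons p _ ih =>
    rw [indepList_cons]
    refine Dominates.trans ?_ ih
    conv => arg 2; rw [← PMF.bind_const p (indepList _)]
    exact .bind fun a => .of_map_cons _ a
  | cons_cons p _ ih => exact .bind fun a => ih.map_cons a

theorem dominates_indepList_of_subperm {ps qs : List (PMF S)} (h : ps.Subperm qs) :
    Dominates (indepList qs) (indepList ps) := by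
  obtain ⟨l, hl, hs⟩ := h
  exact (dominates_indepList_of_sublist hs).trans (dominates_indepList_of_perm hl)

end Domination

/-! ### Pairing a list -/

section Pairs

variable {S : Type}

open Classical in
/-- The classes of the pairs formed by pair-and-average on a list with the given classes. -/
def pairs : List S → List S
  | [] => []
  | c :: cs => if c ∈ cs then c :: pairs (cs.erase c) else pairs cs
  termination_by l => l.length
  decreasing_by
  · exact Nat.lt_succ_of_le List.length_erase_le
  · simp

open Classical in
theorem count_pairs (c : S) (l : List S) : (pairs l).count c = l.count c / 2 := by
  induction l using pairs.induct with
  | case1 => simp [pairs]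
  | case2 a cs h ih =>
    rw [pairs, if_pos h]
    have h1 : 0 < cs.count a := List.count_pos_iff.2 h
    by_cases hc : a = c
    · subst hc
      rw [List.count_cons_self, List.count_cons_self, ih, List.count_erase_self]
      omega
    · rw [List.count_cons_of_ne hc, List.count_cons_of_ne hc, ih, List.count_erase_of_ne (Ne.symm hc)]
  | case3 a cs h ih =>
    rw [pairs, if_neg h, ih]
    have h1 : cs.count a = 0 := List.count_eq_zero.2 h
    by_cases hc : a = c
    · subst hc
      simp [h1]
    · rw [List.count_cons_of_ne hc]

end Pairs

/-! ### The Poisson distribution -/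

section Poisson

open scoped NNReal Nat

/-- The Poisson distribution with mean `r`. -/
def poissonLaw (r : ℝ≥0) : PMF ℕ := (ProbabilityTheory.poissonMeasure r).toPMF

theorem poissonLaw_apply (r : ℝ≥0) (n : ℕ) :
    poissonLaw r n = ENNReal.ofReal (Real.exp (-r)) * ((r : ℝ≥0∞) ^ n * (n ! : ℝ≥0∞)⁻¹) := by
  rw [poissonLaw, MeasureTheory.Measure.toPMF_apply, ProbabilityTheory.poissonMeasure_singleton,
    mul_div_assoc, ENNReal.ofReal_mul (Real.exp_pos _).le, ENNReal.ofReal_div_of_pos (by positivity),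
    ENNReal.ofReal_pow NNReal.zero_le_coe, ENNReal.ofReal_coe_nnreal, ENNReal.ofReal_natCast, div_eq_mul_inv]

theorem poissonLaw_apply_eq_ofReal (r : ℝ≥0) (n : ℕ) :
    poissonLaw r n = ENNReal.ofReal (Real.exp (-r) * r ^ n / n !) :=
  ProbabilityTheory.poissonMeasure_singleton r n

/-- Exponential tilting, the source of both exponential tail bounds: the weights r^n z^n / n! are
again Poisson weights, of mean rz. -/
theorem poissonLaw_mul_pow (r z : ℝ≥0) (n : ℕ) :
    poissonLaw r n * (z : ℝ≥0∞) ^ n =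
      ENNReal.ofReal (Real.exp (r * z - r)) * poissonLaw (r * z) n := by
  rw [poissonLaw_apply, poissonLaw_apply, ← mul_assoc (ENNReal.ofReal (Real.exp (r * z - r))),
    ← ENNReal.ofReal_mul (Real.exp_pos _).le, ← Real.exp_add, ENNReal.coe_mul, mul_pow]
  have : (r : ℝ) * z - r + -((r * z : ℝ≥0) : ℝ) = -r := by push_cast; ring
  rw [this]
  ring

/-- The exponential Markov inequality. -/
theorem prob_poissonLaw_le (r z : ℝ≥0) (C : ℝ≥0∞) (A : Set ℕ) (h : ∀ n ∈ A, 1 ≤ C * (z : ℝ≥0∞) ^ n) :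
    prob (poissonLaw r) A ≤ C * ENNReal.ofReal (Real.exp (r * z - r)) := by
  rw [prob, PMF.toOuterMeasure_apply]
  calc ∑' n, A.indicator (poissonLaw r) n
      ≤ ∑' n, C * ENNReal.ofReal (Real.exp (r * z - r)) * poissonLaw (r * z) n := by
        refine ENNReal.tsum_le_tsum fun n => ?_
        rw [mul_assoc, ← poissonLaw_mul_pow, mul_left_comm]
        by_cases hn : n ∈ A
        · rw [Set.indicator_of_mem hn]
          exact le_mul_of_one_le_right' (h n hn)
        · rw [Set.indicator_of_notMem hn]
          exact zero_le
    _ = _ := by rw [ENNReal.tsum_mul_left, PMF.tsum_coe, mul_one]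

theorem prob_poissonLaw_lower (r : ℝ≥0) (A : Set ℕ) (h : ∀ n ∈ A, (n : ℝ) ≤ r / 2) :
    prob (poissonLaw r) A ≤ ENNReal.ofReal (Real.exp (-r / 8)) := by
  -- Tilting by z = 1/2 leaves the exponent -(1 - log 2) r/2, which is below -r/8.
  refine (prob_poissonLaw_le r (1 / 2) (ENNReal.ofReal ((2 : ℝ) ^ ((r : ℝ) / 2))) A ?_).trans ?_
  · intro n hn
    rw [← ENNReal.ofReal_coe_nnreal, ← ENNReal.ofReal_pow (by positivity),
      ← ENNReal.ofReal_mul (by positivity), ENNReal.one_le_ofReal]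
    push_cast
    rw [one_div, inv_pow, ← div_eq_mul_inv, one_le_div (by positivity), ← Real.rpow_natCast]
    exact Real.rpow_le_rpow_of_exponent_le one_le_two (h n hn)
  · rw [← ENNReal.ofReal_mul (by positivity)]
    refine ENNReal.ofReal_le_ofReal ?_
    rw [Real.rpow_def_of_pos two_pos, ← Real.exp_add]
    refine Real.exp_le_exp.2 ?_
    push_cast
    have := Real.log_two_lt_d9
    nlinarith [r.2]

theorem prob_poissonLaw_upper (r : ℝ≥0) (x : ℝ) (A : Set ℕ) (h : ∀ n ∈ A, x ≤ (n : ℝ)) :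
    prob (poissonLaw r) A ≤ ENNReal.ofReal (Real.exp (r - x * Real.log 2)) := by
  refine (prob_poissonLaw_le r 2 (ENNReal.ofReal ((2 : ℝ) ^ (-x))) A ?_).trans ?_
  · intro n hn
    rw [← ENNReal.ofReal_coe_nnreal, ← ENNReal.ofReal_pow (by positivity),
      ← ENNReal.ofReal_mul (by positivity), ENNReal.one_le_ofReal]
    push_cast
    rw [← Real.rpow_natCast, ← Real.rpow_add two_pos]
    exact Real.one_le_rpow one_le_two (by linarith [h n hn])
  · rw [← ENNReal.ofReal_mul (by positivity)]
    refine ENNReal.ofReal_le_ofReal ?_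
    rw [Real.rpow_def_of_pos two_pos, ← Real.exp_add]
    refine Real.exp_le_exp.2 (le_of_eq ?_)
    push_cast
    ring

/-- Since j! i! ≤ (j+i)!, the factor r^j/j! can be pulled out of the tail, leaving a full Poisson
sum. The power r^j is what the comparison for small means uses. -/
theorem prob_poissonLaw_Ici_le (r : ℝ≥0) (j : ℕ) :
    prob (poissonLaw r) (Set.Ici j) ≤ ENNReal.ofReal ((r : ℝ) ^ j / j !) := by
  have hinj : Function.Injective fun i : ℕ => j + i := add_right_injective j
  have hrange : Set.Ici j = Set.range fun i : ℕ => j + i := by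
    ext n
    simp [le_iff_exists_add, eq_comm]
  rw [prob, PMF.toOuterMeasure_apply, hrange, ← tsum_subtype, tsum_range _ hinj]
  calc ∑' i, poissonLaw r (j + i)
      ≤ ∑' i, ENNReal.ofReal ((r : ℝ) ^ j / j !) * poissonLaw r i := by
        refine ENNReal.tsum_le_tsum fun i => ?_
        rw [poissonLaw_apply_eq_ofReal, poissonLaw_apply_eq_ofReal,
          ← ENNReal.ofReal_mul (by positivity)]
        refine ENNReal.ofReal_le_ofReal ?_
        have h1 : ((j ! : ℕ) : ℝ) * (i ! : ℕ) ≤ ((j + i)! : ℕ) := by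
          exact_mod_cast Nat.le_of_dvd (Nat.factorial_pos _) (Nat.factorial_mul_factorial_dvd_factorial_add j i)
        calc Real.exp (-r) * (r : ℝ) ^ (j + i) / ((j + i)! : ℕ)
            ≤ Real.exp (-r) * (r : ℝ) ^ (j + i) / (((j ! : ℕ) : ℝ) * (i ! : ℕ)) := by gcongr
          _ = _ := by rw [pow_add]; field_simp
    _ = _ := by rw [ENNReal.tsum_mul_left, PMF.tsum_coe, mul_one]

end Poisson

/-! ### Monotone coupling -/

section MonotoneCoupling

open MeasureTheory Filter Topology

/-- The distribution function `n ↦ μ({k | k < n})`. -/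
def distFun (μ : PMF ℕ) (n : ℕ) : ℝ := (prob μ (Set.Iio n)).toReal

theorem distFun_mono (μ : PMF ℕ) : Monotone (distFun μ) := fun _ _ h =>
  ENNReal.toReal_mono (prob_ne_top _ _) (prob_mono _ (Set.Iio_subset_Iio h))

theorem prob_Iio_eq_sum (μ : PMF ℕ) (n : ℕ) : prob μ (Set.Iio n) = ∑ k ∈ Finset.range n, μ k := by
  rw [prob, ← Finset.coe_range, PMF.toOuterMeasure_apply_finset]

theorem distFun_zero (μ : PMF ℕ) : distFun μ 0 = 0 := by
  rw [distFun, prob_Iio_eq_sum]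
  simp

theorem distFun_le_one (μ : PMF ℕ) (n : ℕ) : distFun μ n ≤ 1 :=
  ENNReal.toReal_le_of_le_ofReal zero_le_one (by simpa using prob_le_one μ _)

theorem distFun_tendsto (μ : PMF ℕ) : Tendsto (distFun μ) atTop (𝓝 1) := by
  have h := ENNReal.tendsto_nat_tsum (fun k => μ k)
  rw [μ.tsum_coe] at h
  have h' := (ENNReal.tendsto_toReal ENNReal.one_ne_top).comp h
  rw [ENNReal.toReal_one] at h'
  refine h'.congr fun n => ?_
  rw [distFun, prob_Iio_eq_sum, Function.comp]

theorem volume_Ioc_distFun (μ : PMF ℕ) (n : ℕ) :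
    volume (Set.Ioc (distFun μ n) (distFun μ (n + 1))) = μ n := by
  rw [Real.volume_Ioc, distFun, distFun, prob_Iio_eq_sum, prob_Iio_eq_sum, Finset.sum_range_succ,
    ENNReal.toReal_add _ (μ.apply_ne_top n), add_sub_cancel_left,
    ENNReal.ofReal_toReal (μ.apply_ne_top n)]
  rw [← prob_Iio_eq_sum]
  exact prob_ne_top _ _

theorem Ioc_distFun_subset (μ : PMF ℕ) (n : ℕ) :
    Set.Ioc (distFun μ n) (distFun μ (n + 1)) ⊆ Set.Ioc 0 1 :=
  Set.Ioc_subset_Ioc ((distFun_zero μ).symm.le.trans (distFun_mono μ (Nat.zero_le n)))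
    (distFun_le_one μ _)

theorem Ioo_subset_iUnion_Ioc_distFun (μ : PMF ℕ) :
    Set.Ioo 0 1 ⊆ ⋃ n, Set.Ioc (distFun μ n) (distFun μ (n + 1)) := by
  classical
  rintro u ⟨hu0, hu1⟩
  have hex : ∃ n, u ≤ distFun μ n := by
    obtain ⟨n, hn⟩ := ((distFun_tendsto μ).eventually (lt_mem_nhds hu1)).exists
    exact ⟨n, hn.le⟩
  obtain ⟨n, hn⟩ : ∃ n, Nat.find hex = n + 1 := by
    refine Nat.exists_eq_succ_of_ne_zero fun h => ?_
    have := Nat.find_spec hex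
    rw [h, distFun_zero] at this
    exact hu0.not_ge this
  refine Set.mem_iUnion.2 ⟨n, ?_, ?_⟩
  · exact not_le.1 (Nat.find_min hex (by omega))
  · rw [← hn]
    exact Nat.find_spec hex

theorem tsum_volume_inter_Ioc_distFun (ν : PMF ℕ) {I : Set ℝ} (hI : MeasurableSet I)
    (hI' : I ⊆ Set.Ioc 0 1) :
    ∑' n, volume (I ∩ Set.Ioc (distFun ν n) (distFun ν (n + 1))) = volume I := by
  rw [← measure_iUnion, ← Set.inter_iUnion]
  · refine le_antisymm (measure_mono Set.inter_subset_left) ?_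
    -- The intervals cover (0,1) but may miss the point 1, when the distribution function never
    -- reaches 1; that point is null.
    calc volume I ≤ volume ((I ∩ ⋃ n, Set.Ioc (distFun ν n) (distFun ν (n + 1))) ∪ {1}) := by
          refine measure_mono fun u hu => ?_
          rcases (hI' hu).2.eq_or_lt with h | h
          · exact Or.inr h
          · exact Or.inl ⟨hu, Ioo_subset_iUnion_Ioc_distFun ν ⟨(hI' hu).1, h⟩⟩
      _ ≤ _ := (measure_union_le _ _).trans (by simp)
  · intro i j hij
    exact ((distFun_mono ν).pairwise_disjoint_on_Ioc_succ hij).mono Set.inter_subset_right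
      Set.inter_subset_right
  · exact fun n => hI.inter measurableSet_Ioc

/-- The monotone (quantile) coupling of two laws on `ℕ`. -/
theorem exists_monotone_coupling (μ ν : PMF ℕ) :
    ∃ γ : PMF (ℕ × ℕ), γ.map Prod.fst = μ ∧ γ.map Prod.snd = ν ∧
      ∀ z ∈ γ.support, prob ν (Set.Iio z.2) < prob μ (Set.Iio (z.1 + 1)) := by
  classical
  -- One uniform u in (0,1] drives both coordinates: the first is x when u ∈ I x, the second is y
  -- when u ∈ J y.
  set I : ℕ → Set ℝ := fun n => Set.Ioc (distFun μ n) (distFun μ (n + 1)) with hI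
  set J : ℕ → Set ℝ := fun n => Set.Ioc (distFun ν n) (distFun ν (n + 1)) with hJ
  have h1 : ∀ x, ∑' y, volume (I x ∩ J y) = μ x := fun x => by
    rw [tsum_volume_inter_Ioc_distFun ν measurableSet_Ioc (Ioc_distFun_subset μ x),
      volume_Ioc_distFun]
  have h2 : ∀ y, ∑' x, volume (I x ∩ J y) = ν y := fun y => by
    simp_rw [Set.inter_comm (I _)]
    rw [tsum_volume_inter_Ioc_distFun μ measurableSet_Ioc (Ioc_distFun_subset ν y),
      volume_Ioc_distFun]
  have hsum : ∑' z : ℕ × ℕ, volume (I z.1 ∩ J z.2) = 1 := by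
    rw [ENNReal.tsum_prod']
    simp only [h1, PMF.tsum_coe]
  obtain ⟨γ, hγ⟩ : ∃ γ : PMF (ℕ × ℕ), ∀ z, γ z = volume (I z.1 ∩ J z.2) :=
    ⟨⟨fun z => volume (I z.1 ∩ J z.2), hsum ▸ ENNReal.summable.hasSum⟩, fun _ => rfl⟩
  refine ⟨γ, ?_, ?_, ?_⟩
  · ext x
    rw [PMF.map_apply, ENNReal.tsum_prod', tsum_eq_single x]
    · rw [← h1 x]
      exact tsum_congr fun y => (if_pos rfl).trans (hγ _)
    · intro x' hx'
      simp [hx'.symm]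
  · ext y
    rw [PMF.map_apply, ENNReal.tsum_prod', ENNReal.tsum_comm, tsum_eq_single y]
    · rw [← h2 y]
      exact tsum_congr fun x => (if_pos rfl).trans (hγ _)
    · intro y' hy'
      simp [hy'.symm]
  · rintro ⟨x, y⟩ hz
    -- Positive mass yields a common u, lying strictly above the left end of J y and at most the
    -- right end of I x.
    have hne : (I x ∩ J y).Nonempty := by
      rw [PMF.mem_support_iff, hγ] at hz
      exact nonempty_of_measure_ne_zero hz
    obtain ⟨u, hux, huy⟩ := hne
    exact (ENNReal.toReal_lt_toReal (prob_ne_top _ _) (prob_ne_top _ _)).1 (huy.1.trans_le hux.2)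

end MonotoneCoupling

/-! ### Independent families -/

section PiLaw

open MeasureTheory

variable {S : Type} [Fintype S] {α β : Type} [Countable α] [Countable β]

/-- Independent sampling of one value for each index. -/
def piLaw (γ : S → PMF α) : PMF (S → α) :=
  letI : MeasurableSpace α := ⊤
  (Measure.pi fun c => (γ c).toMeasure).toPMF

theorem piLaw_apply (γ : S → PMF α) (f : S → α) : piLaw γ f = ∏ c, γ c (f c) := by
  let : MeasurableSpace α := ⊤
  rw [piLaw, Measure.toPMF_apply, Measure.pi_singleton]
  exact Finset.prod_congr rfl fun c _ => PMF.toMeasure_apply_singleton _ _ trivial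

theorem piLaw_map (γ : S → PMF α) (g : α → β) :
    (piLaw γ).map (fun f c => g (f c)) = piLaw fun c => (γ c).map g := by
  let : MeasurableSpace α := ⊤
  let : MeasurableSpace β := ⊤
  have hg : Measurable g := measurable_from_top
  apply PMF.toMeasure_injective
  have hm : Measurable fun (f : S → α) c => g (f c) := by fun_prop
  rw [← PMF.toMeasure_map _ _ hm, piLaw, piLaw, Measure.toPMF_toMeasure,
    Measure.toPMF_toMeasure]
  rw [Measure.pi_map_pi (fun c => hg.aemeasurable)]
  simp only [PMF.toMeasure_map _ _ hg]

theorem piLaw_map_eval (γ : S → PMF α) (c : S) : (piLaw γ).map (fun f => f c) = γ c := by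
  let : MeasurableSpace α := ⊤
  apply PMF.toMeasure_injective
  have hm : Measurable fun f : S → α => f c := by fun_prop
  rw [← PMF.toMeasure_map _ _ hm, piLaw, Measure.toPMF_toMeasure]
  exact (measurePreserving_eval (fun c => (γ c).toMeasure) c).map_eq

theorem prob_piLaw_exists_le (γ : S → PMF α) (A : S → Set α) :
    prob (piLaw γ) {f | ∃ c, f c ∈ A c} ≤ ∑ c, prob (γ c) (A c) := by
  calc prob (piLaw γ) {f | ∃ c, f c ∈ A c} = prob (piLaw γ) (⋃ c, {f | f c ∈ A c}) := by
        congr 1; ext f; simp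
    _ ≤ ∑' c, prob (piLaw γ) {f | f c ∈ A c} := measure_iUnion_le _
    _ = ∑ c, prob (γ c) (A c) := by
        rw [tsum_fintype]
        refine Finset.sum_congr rfl fun c _ => ?_
        conv_rhs => rw [← piLaw_map_eval γ c, prob_map]
        rfl

end PiLaw

/-! ### Counts of independent samples -/

section Counts

open scoped NNReal Nat

variable {S : Type}

open Classical in
/-- The vector of multiplicities of a list. -/
def counts (l : List S) : S → ℕ := fun c => l.count c

open Classical in
theorem counts_cons (a : S) (l : List S) :
    counts (a :: l) = counts l + Pi.single a 1 := by
  funext c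
  simp only [counts, List.count_cons, Pi.add_apply, Pi.single_apply, beq_iff_eq, eq_comm (a := c)]

open Classical in
theorem map_add_single_apply (μ : PMF (S → ℕ)) (a : S) (k : S → ℕ) :
    μ.map (· + Pi.single a 1) k = if 1 ≤ k a then μ (k - Pi.single a 1) else 0 := by
  rw [PMF.map_apply]
  split_ifs with h
  · rw [tsum_eq_single (k - Pi.single a 1)]
    · rw [if_pos]
      refine (tsub_add_cancel_of_le ?_).symm
      intro c
      by_cases hc : c = a
      · subst hc; simpa using h
      · simp [hc]
    · intro k' hk'
      rw [if_neg]
      rintro rfl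
      simp at hk'
  · refine ENNReal.tsum_eq_zero.2 fun k' => if_neg ?_
    rintro rfl
    simp at h

variable [Fintype S]

/-- The multinomial weight of a vector of multiplicities. -/
def multiWeight (p : S → ℝ≥0∞) (k : S → ℕ) : ℝ≥0∞ := ∏ c, p c ^ k c * ((k c)! : ℝ≥0∞)⁻¹

open Classical in
-- The recursion behind the multinomial formula: summing the factors k_a over a gives m + 1, which
-- turns m! into (m+1)!.
theorem mul_multiWeight_sub_single (p : S → ℝ≥0∞) (k : S → ℕ) (a : S) (h : 1 ≤ k a) :
    p a * multiWeight p (k - Pi.single a 1 : S → ℕ) = k a * multiWeight p k := by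
  rw [multiWeight, multiWeight, ← Finset.mul_prod_erase _ _ (Finset.mem_univ a),
    ← Finset.mul_prod_erase _ (fun c => p c ^ k c * ((k c)! : ℝ≥0∞)⁻¹) (Finset.mem_univ a),
    ← mul_assoc (p a), ← mul_assoc (k a : ℝ≥0∞)]
  congr 1
  · obtain ⟨j, hj⟩ := Nat.exists_eq_add_of_le' h
    have hf : ((j + 1 : ℕ) : ℝ≥0∞) * ((j + 1)! : ℝ≥0∞)⁻¹ = (j ! : ℝ≥0∞)⁻¹ := by
      rw [Nat.factorial_succ, Nat.cast_mul, ENNReal.mul_inv (by simp) (by simp), ← mul_assoc,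
        ENNReal.mul_inv_cancel (by simp) (by simp), one_mul]
    simp only [Pi.sub_apply, Pi.single_eq_same, hj, Nat.add_sub_cancel]
    rw [← hf]
    ring
  · refine Finset.prod_congr rfl fun c hc => ?_
    simp [(Finset.mem_erase.1 hc).1]

open Classical in
/-- The multiplicities of independent samples have the multinomial distribution. -/
theorem iidList_map_counts_apply (p : PMF S) (m : ℕ) (k : S → ℕ) :
    (iidList p m).map counts k = if ∑ c, k c = m then m ! * multiWeight p k else 0 := by
  induction m generalizing k with
  | zero =>
    rw [iidList_zero, PMF.pure_map, PMF.pure_apply]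
    have h0 : counts ([] : List S) = 0 := by funext c; simp [counts]
    rw [h0]
    by_cases hk : k = 0
    · subst hk
      simp [multiWeight]
    · rw [if_neg hk, if_neg]
      intro h
      exact hk (funext fun c => by simpa using (Finset.sum_eq_zero_iff.1 h) c (Finset.mem_univ c))
  | succ m ih =>
    have hstep : (iidList p (m + 1)).map counts =
        p.bind fun a => ((iidList p m).map counts).map (· + Pi.single a 1) := by
      rw [iidList_succ, PMF.map_bind]
      simp only [PMF.map_comp, Function.comp_def, counts_cons]
    have hsub : ∀ a, 1 ≤ k a → ∑ c, k c = (∑ c, (k - Pi.single a 1 : S → ℕ) c) + 1 := by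
      intro a ha
      have h1 : k = (k - Pi.single a 1 : S → ℕ) + (Pi.single a 1 : S → ℕ) := by
        funext c
        by_cases hc : c = a
        · subst hc; simp; omega
        · simp [hc]
      conv_lhs => rw [h1]
      simp [Finset.sum_add_distrib]
    rw [hstep, PMF.bind_apply, tsum_fintype]
    simp only [map_add_single_apply, ih]
    split_ifs with hk
    · calc _ = ∑ a, (k a : ℝ≥0∞) * (m ! * multiWeight p k) := by
            refine Finset.sum_congr rfl fun a _ => ?_
            by_cases ha : 1 ≤ k a
            · rw [if_pos ha, if_pos (by have := hsub a ha; omega), mul_left_comm,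
                mul_multiWeight_sub_single _ _ _ ha, mul_left_comm]
            · rw [if_neg ha, mul_zero, show k a = 0 by omega, Nat.cast_zero, zero_mul]
        _ = _ := by
            rw [← Finset.sum_mul, ← Nat.cast_sum, hk, ← mul_assoc, ← Nat.cast_mul,
              Nat.factorial_succ]
    · refine Finset.sum_eq_zero fun a _ => ?_
      by_cases ha : 1 ≤ k a
      · rw [if_pos ha, if_neg (by have := hsub a ha; omega), mul_zero]
      · rw [if_neg ha, mul_zero]

open Classical in
/-- For a Poisson number of independent samples, the multiplicities are independent Poisson
variables. -/
theorem poissonLaw_bind_counts (p : PMF S) (r : ℝ≥0) :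
    ((poissonLaw r).bind fun m => (iidList p m).map counts) =
      piLaw fun c => poissonLaw (r * (p c).toNNReal) := by
  ext k
  -- The total of the multiplicities determines the sample size, so a single term of the Poisson
  -- mixture survives.
  rw [PMF.bind_apply, piLaw_apply, tsum_eq_single (∑ c, k c)]
  · have hp : ∀ c, ((p c).toNNReal : ℝ≥0∞) = p c := fun c => ENNReal.coe_toNNReal (p.apply_ne_top c)
    have hexp : ENNReal.ofReal (Real.exp (-r)) =
        ∏ c, ENNReal.ofReal (Real.exp (-((r * (p c).toNNReal : ℝ≥0) : ℝ))) := by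
      rw [← ENNReal.ofReal_prod_of_nonneg fun c _ => (Real.exp_pos _).le, ← Real.exp_sum,
        Finset.sum_neg_distrib]
      congr 3
      push_cast
      rw [← Finset.mul_sum]
      have h1 : ∑ c, ((p c).toNNReal : ℝ) = 1 := by
        have h := p.tsum_coe
        rw [tsum_fintype] at h
        have h' := congrArg ENNReal.toReal h
        rwa [ENNReal.toReal_sum fun c _ => p.apply_ne_top c] at h'
      exact (mul_one _).symm.trans (congrArg _ h1.symm)
    rw [iidList_map_counts_apply, if_pos rfl, poissonLaw_apply, multiWeight]
    simp only [poissonLaw_apply]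
    simp only [Finset.prod_mul_distrib, ENNReal.coe_mul, hp, mul_pow]
    rw [← hexp, Finset.prod_pow_eq_pow_sum]
    have hf : ((∑ c, k c)! : ℝ≥0∞)⁻¹ * ((∑ c, k c)! : ℝ≥0∞) = 1 :=
      ENNReal.inv_mul_cancel (by simp [Nat.factorial_ne_zero]) (by simp)
    refine Eq.trans ?_ (mul_one _)
    rw [← hf]
    ring
  · intro m hm
    rw [iidList_map_counts_apply, if_neg hm.symm, mul_zero]

end Counts

section SampleCoupling

/-! ### Coupling the pairs of one sample with another sample -/

open scoped NNReal Nat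

theorem prob_bind_le_prob {α β : Type} (μ : PMF α) (f : α → PMF β) (A : Set β) (B : Set α)
    (h : ∀ a ∉ B, ∀ b ∈ (f a).support, b ∉ A) : prob (μ.bind f) A ≤ prob μ B := by
  rw [prob_bind, show prob μ B = _ from PMF.toOuterMeasure_apply _ _]
  refine ENNReal.tsum_le_tsum fun a => ?_
  by_cases ha : a ∈ B
  · rw [Set.indicator_of_mem ha]
    exact mul_le_of_le_one_right' (prob_le_one _ _)
  · rw [prob_eq_zero_of_forall (h a ha), mul_zero]
    exact zero_le

theorem prob_inter_support_mono {α : Type} (μ : PMF α) {A B : Set α}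
    (h : ∀ a ∈ μ.support, a ∈ A → a ∈ B) : prob μ A ≤ prob μ B :=
  PMF.toOuterMeasure_mono _ fun a ha => h a ha.2 ha.1

theorem prob_Iio_le_of_prob_Ici_le {μ ν : PMF ℕ} {i j : ℕ}
    (h : prob ν (Set.Ici j) ≤ prob μ (Set.Ici i)) : prob μ (Set.Iio i) ≤ prob ν (Set.Iio j) := by
  have h1 := prob_compl μ (Set.Iio i)
  have h2 := prob_compl ν (Set.Iio j)
  rw [Set.compl_Iio] at h1 h2
  refine (ENNReal.add_le_add_iff_right (prob_ne_top μ (Set.Ici i))).1 ?_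
  rw [h1, ← h2]
  gcongr

/-- With (2j)! ≤ j! (2j)^j and e^a ≤ e^{4j} ≤ 55^j, the claim reduces to 110 j b ≤ a², which the
bounds on b and j give. -/
theorem pow_div_factorial_le_exp_mul_pow_div {a b κ : ℝ} {j : ℕ} (hb : 0 ≤ b) (hκ : 60 ≤ κ)
    (h2 : b ≤ a ^ 2 / (20 * κ ^ 3)) (hj : (j : ℝ) ≤ 2 * κ) (haj : a ≤ 4 * j) :
    b ^ j / j ! ≤ Real.exp (-a) * a ^ (2 * j) / (2 * j)! := by
  have hfac : ((2 * j)! : ℝ) ≤ j ! * (2 * j) ^ j := by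
    have h3 : (2 * j)! ≤ j ! * (2 * j) ^ j := by
      calc (2 * j)! = j ! * (j + 1).ascFactorial j := by
            rw [Nat.factorial_mul_ascFactorial, two_mul]
        _ ≤ j ! * (2 * j) ^ j := by
            gcongr
            refine (Nat.ascFactorial_le_pow_add j j).trans (by rw [two_mul])
    exact_mod_cast h3
  have hexp : Real.exp a ≤ 55 ^ j := by
    calc Real.exp a ≤ Real.exp (j * 4) := Real.exp_le_exp.2 (by linarith)
      _ = Real.exp 4 ^ j := by rw [Real.exp_nat_mul]
      _ ≤ 55 ^ j := by
        gcongr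
        have h := Real.exp_one_lt_d9.le
        calc Real.exp 4 = Real.exp 1 ^ 4 := by rw [← Real.exp_nat_mul]; norm_num
          _ ≤ 2.7182818286 ^ 4 := by gcongr
          _ ≤ 55 := by norm_num
  have hmain : b * 55 * (2 * j) ≤ a ^ 2 := by
    have h3 : b * 55 * (2 * j) ≤ a ^ 2 / (20 * κ ^ 3) * 55 * (2 * (2 * κ)) := by gcongr
    refine h3.trans ?_
    rw [div_mul_eq_mul_div, div_mul_eq_mul_div, div_le_iff₀ (by positivity)]
    have : 0 ≤ a ^ 2 * κ := by positivity
    nlinarith [mul_le_mul_of_nonneg_left (show (3600 : ℝ) ≤ κ ^ 2 by nlinarith) this]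
  rw [Real.exp_neg, inv_mul_eq_div, div_div, div_le_div_iff₀ (by positivity) (by positivity)]
  calc b ^ j * (Real.exp a * (2 * j)!) ≤ b ^ j * (55 ^ j * (j ! * (2 * j) ^ j)) := by gcongr
    _ = (b * 55 * (2 * j)) ^ j * j ! := by rw [mul_pow, mul_pow]; ring
    _ ≤ (a ^ 2) ^ j * j ! := by gcongr
    _ = a ^ (2 * j) * j ! := by rw [pow_mul]

/-- If a ≤ 4j, the point mass of Poisson(a) at 2j alone outweighs the tail of Poisson(b) from j on.
If a > 4j, then 2j < a/2, and the lower tail of Poisson(a) together with b ≤ 1/1000 suffices. -/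
theorem prob_poissonLaw_Ici_le_Ici {a b : ℝ≥0} {κ : ℝ} {j : ℕ} (hκ : 60 ≤ κ) (hj1 : 1 ≤ j)
    (h2 : (b : ℝ) ≤ a ^ 2 / (20 * κ ^ 3)) (hj : (j : ℝ) ≤ 2 * κ) (ha : (a : ℝ) ≤ κ) :
    prob (poissonLaw a) (Set.Iio (2 * j)) ≤ prob (poissonLaw b) (Set.Iio j) := by
  have hb : (b : ℝ) ≤ 1 / 1000 := by
    refine h2.trans ?_
    rw [div_le_iff₀ (by positivity)]
    have : (a : ℝ) ^ 2 ≤ κ ^ 2 := by gcongr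
    nlinarith [mul_le_mul_of_nonneg_left hκ (sq_nonneg κ)]
  rcases le_or_gt (a : ℝ) (4 * j) with haj | haj
  · refine prob_Iio_le_of_prob_Ici_le ((prob_poissonLaw_Ici_le b j).trans ?_)
    calc ENNReal.ofReal ((b : ℝ) ^ j / j !) ≤ poissonLaw a (2 * j) := by
          rw [poissonLaw_apply_eq_ofReal]
          exact ENNReal.ofReal_le_ofReal
            (pow_div_factorial_le_exp_mul_pow_div b.2 hκ h2 hj haj)
      _ = prob (poissonLaw a) {2 * j} := (PMF.toOuterMeasure_apply_singleton _ _).symm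
      _ ≤ _ := prob_mono _ (by simp)
  · have h1 : prob (poissonLaw a) (Set.Iio (2 * j)) ≤ ENNReal.ofReal (Real.exp (-a / 8)) := by
      refine prob_poissonLaw_lower a _ fun n hn => ?_
      have : (n : ℝ) ≤ 2 * j := by exact_mod_cast (Set.mem_Iio.1 hn).le
      linarith
    have hj1' : (1 : ℝ) ≤ j := by exact_mod_cast hj1
    have h3 : Real.exp (-a / 8) ≤ 2 / 3 := by
      calc Real.exp (-a / 8) ≤ Real.exp (-(1 / 2)) := Real.exp_le_exp.2 (by linarith)
        _ = (Real.exp (1 / 2))⁻¹ := Real.exp_neg _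
        _ ≤ (3 / 2)⁻¹ := by
            gcongr
            linarith [Real.add_one_le_exp (1 / 2 : ℝ)]
        _ = 2 / 3 := by norm_num
    have h4 : prob (poissonLaw b) (Set.Ici j) ≤ ENNReal.ofReal (1 / 1000) := by
      refine (prob_poissonLaw_Ici_le b j).trans (ENNReal.ofReal_le_ofReal ?_)
      calc (b : ℝ) ^ j / j ! ≤ (b : ℝ) ^ j := div_le_self (by positivity)
              (by exact_mod_cast Nat.factorial_pos j)
        _ ≤ (b : ℝ) ^ 1 := pow_le_pow_of_le_one b.coe_nonneg (by linarith) hj1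
        _ ≤ 1 / 1000 := by rwa [pow_one]
    have h5 := prob_compl (poissonLaw b) (Set.Iio j)
    rw [Set.compl_Iio] at h5
    refine (ENNReal.add_le_add_iff_right (prob_ne_top (poissonLaw b) (Set.Ici j))).1 ?_
    rw [h5]
    refine (add_le_add (h1.trans (ENNReal.ofReal_le_ofReal h3)) h4).trans ?_
    rw [← ENNReal.ofReal_add (by norm_num) (by norm_num), ENNReal.ofReal_le_one]
    norm_num

/-- A Poisson variable with a much smaller mean can be coupled to lie below half of the other,
except with small probability. -/
theorem exists_poissonLaw_coupling {a b : ℝ≥0} {κ : ℝ} (hκ : 60 ≤ κ)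
    (h1 : (b : ℝ) ≤ a / (4 * κ)) (h2 : (b : ℝ) ≤ a ^ 2 / (20 * κ ^ 3)) :
    ∃ γ : PMF (ℕ × ℕ), γ.map Prod.fst = poissonLaw a ∧ γ.map Prod.snd = poissonLaw b ∧
      prob γ {z | z.1 / 2 < z.2} ≤ ENNReal.ofReal ((2 * a + b) * Real.exp (-κ / 16)) := by
  obtain ⟨γ, hγ1, hγ2, hγ⟩ := exists_monotone_coupling (poissonLaw a) (poissonLaw b)
  refine ⟨γ, hγ1, hγ2, ?_⟩
  -- For a ≥ κ, failure forces X ≤ a/2 or Y ≥ a/8, and both are exponentially unlikely under any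
  -- coupling.
  rcases le_or_gt κ a with ha | ha
  · have hsub : {z : ℕ × ℕ | z.1 / 2 < z.2} ⊆
        Prod.fst ⁻¹' {n | (n : ℝ) ≤ a / 2} ∪ Prod.snd ⁻¹' {n | (a : ℝ) / 8 ≤ n} := by
      rintro ⟨x, y⟩ (hz : x / 2 < y)
      by_cases hx : (x : ℝ) ≤ a / 2
      · exact Or.inl hx
      · right
        have h3 : x + 1 ≤ 2 * y := by omega
        have h4 : (x : ℝ) + 1 ≤ 2 * y := by exact_mod_cast h3
        change (a : ℝ) / 8 ≤ y
        linarith [a.2]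
    have hb : (b : ℝ) ≤ a / 240 := h1.trans (by gcongr; linarith)
    calc prob γ {z | z.1 / 2 < z.2}
        ≤ prob (poissonLaw a) {n | (n : ℝ) ≤ a / 2} + prob (poissonLaw b) {n | (a : ℝ) / 8 ≤ n} := by
          refine (prob_mono γ hsub).trans ((prob_union_le _ _ _).trans ?_)
          rw [← hγ1, ← hγ2, prob_map, prob_map]
      _ ≤ ENNReal.ofReal (Real.exp (-κ / 16)) + ENNReal.ofReal (Real.exp (-κ / 16)) := by
          refine add_le_add ((prob_poissonLaw_lower a _ fun n hn => hn).trans ?_)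
            ((prob_poissonLaw_upper b _ _ fun n hn => hn).trans ?_)
          · exact ENNReal.ofReal_le_ofReal (Real.exp_le_exp.2 (by linarith [a.2]))
          · refine ENNReal.ofReal_le_ofReal (Real.exp_le_exp.2 ?_)
            have := Real.log_two_gt_d9
            nlinarith [a.2]
      _ ≤ _ := by
          rw [← ENNReal.ofReal_add (by positivity) (by positivity)]
          refine ENNReal.ofReal_le_ofReal ?_
          have := Real.exp_pos (-κ / 16)
          nlinarith [b.2]
  -- For a < κ, the quantile property rules out failure at every y ≤ K ≤ 2κ. What remains is P(Y >
  -- K) ≤ b^{K+1} ≤ b e^{-K}; one factor b is kept so that the bound can be summed over cosets.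
  · set K := ⌈κ⌉₊ with hK
    have hK1 : κ ≤ K := Nat.le_ceil κ
    have hK2 : (K : ℝ) ≤ 2 * κ := by
      have := (Nat.ceil_lt_add_one (show 0 ≤ κ by linarith)).le
      linarith
    have hb : (b : ℝ) ≤ Real.exp (-1) := by
      have h3 : (b : ℝ) ≤ 1 / 4 := h1.trans (by rw [div_le_iff₀ (by positivity)]; linarith)
      have h4 : Real.exp (-1) = (Real.exp 1)⁻¹ := Real.exp_neg _
      have h5 : (4 : ℝ)⁻¹ ≤ (Real.exp 1)⁻¹ := by
        gcongr
        linarith [Real.exp_one_lt_d9]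
      linarith
    calc prob γ {z | z.1 / 2 < z.2} ≤ prob γ (Prod.snd ⁻¹' Set.Ici (K + 1)) := by
          refine prob_inter_support_mono γ ?_
          rintro ⟨x, y⟩ hz (hxy : x / 2 < y)
          change K + 1 ≤ y
          by_contra hy
          have h3 := prob_poissonLaw_Ici_le_Ici (j := y) hκ (by omega) h2
            (le_trans (by exact_mod_cast (by omega : y ≤ K)) hK2) ha.le
          refine (hγ _ hz).not_ge (le_trans (prob_mono _ ?_) h3)
          exact Set.Iio_subset_Iio (by dsimp only; omega)
      _ = prob (poissonLaw b) (Set.Ici (K + 1)) := by rw [← hγ2, prob_map]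
      _ ≤ _ := by
          refine (prob_poissonLaw_Ici_le b _).trans (ENNReal.ofReal_le_ofReal ?_)
          calc (b : ℝ) ^ (K + 1) / (K + 1)! ≤ (b : ℝ) ^ (K + 1) := div_le_self (by positivity)
                (by exact_mod_cast Nat.factorial_pos _)
            _ = b * b ^ K := by ring
            _ ≤ b * Real.exp (-1) ^ K := by gcongr
            _ = b * Real.exp (-K) := by rw [← Real.exp_nat_mul]; ring_nf
            _ ≤ b * Real.exp (-κ / 16) := by gcongr; linarith
            _ ≤ _ := by gcongr; linarith [a.2]

/-! ### Poissonization of samples -/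

variable {S : Type}

theorem counts_le_of_sublist {l l' : List S} (h : l.Sublist l') : counts l ≤ counts l' := by
  classical
  intro c
  exact h.count_le _

variable [Fintype S]

/-- A sample of fixed size, jointly with independent Poisson multiplicities that agree with it up to
the difference of the sizes. -/
theorem exists_poissonized (p : PMF S) (r : ℝ≥0) (m : ℕ) :
    ∃ J : PMF (List S × (S → ℕ)), J.map Prod.fst = iidList p m ∧
      J.map Prod.snd = piLaw (fun c => poissonLaw (r * (p c).toNNReal)) ∧
      prob J {x | ¬ x.2 ≤ counts x.1} ≤ prob (poissonLaw r) {n | m < n} ∧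
      prob J {x | ¬ counts x.1 ≤ x.2} ≤ prob (poissonLaw r) {n | n < m} := by
  -- A Poisson-size sample is extended or truncated to length m. For n ≤ m it is a prefix of the
  -- fixed-size sample; for n ≥ m the roles are reversed, the truncated difference m - n being 0.
  refine ⟨(poissonLaw r).bind fun n => (iidList p n).bind fun l =>
    (iidList p (m - n)).map fun l' => ((l ++ l').take m, counts l), ?_, ?_, ?_, ?_⟩
  · simp only [PMF.map_bind, PMF.map_comp, Function.comp_def]
    have : ∀ n, ((iidList p n).bind fun l => (iidList p (m - n)).map fun l' => (l ++ l').take m) =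
        iidList p m := by
      intro n
      have h := congrArg (PMF.map (List.take m)) (iidList_add p n (m - n))
      rw [iidList_map_take, PMF.map_bind] at h
      simp only [PMF.map_comp, Function.comp_def] at h
      rw [← h, min_eq_left (by omega)]
    simp only [this, PMF.bind_const]
  · simp only [PMF.map_bind, PMF.map_comp, Function.comp_def]
    rw [← poissonLaw_bind_counts]
    congr 1; funext n
    rw [← PMF.bind_pure_comp]
    congr 1; funext l
    exact PMF.map_const _ _
  · refine prob_bind_le_prob _ _ _ _ fun n hn x hx => ?_
    simp only [PMF.mem_support_bind_iff, PMF.mem_support_map_iff] at hx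
    obtain ⟨l, hl, l', hl', rfl⟩ := hx
    have h1 := length_of_mem_support_iidList hl
    have h2 := length_of_mem_support_iidList hl'
    have hn' : n ≤ m := not_lt.1 hn
    refine not_not.2 (counts_le_of_sublist ?_)
    dsimp only
    rw [List.take_of_length_le (by simp; omega)]
    exact List.sublist_append_left _ _
  · refine prob_bind_le_prob _ _ _ _ fun n hn x hx => ?_
    simp only [PMF.mem_support_bind_iff, PMF.mem_support_map_iff] at hx
    obtain ⟨l, hl, l', hl', rfl⟩ := hx
    have h1 := length_of_mem_support_iidList hl
    have hn' : m ≤ n := not_lt.1 hn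
    refine not_not.2 (counts_le_of_sublist ?_)
    dsimp only
    rw [List.take_append_of_le_length (by omega)]
    exact List.take_sublist _ _

theorem sum_toReal_eq_one (p : PMF S) : ∑ c, (p c).toReal = 1 := by
  have h := p.tsum_coe
  rw [tsum_fintype] at h
  rw [← ENNReal.toReal_sum fun c _ => p.apply_ne_top c, h, ENNReal.toReal_one]

/-- Poissonization: couplings of Poisson variables give a coupling of samples. -/
theorem exists_sample_coupling (p w : PMF S) (r r' : ℝ≥0) (M M' : ℕ) (δ : S → ℝ≥0∞)
    (h : ∀ c, ∃ γ : PMF (ℕ × ℕ), γ.map Prod.fst = poissonLaw (r * (p c).toNNReal) ∧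
      γ.map Prod.snd = poissonLaw (r' * (w c).toNNReal) ∧ prob γ {z | z.1 / 2 < z.2} ≤ δ c) :
    ∃ Γ : PMF (List S × List S), Γ.map Prod.fst = iidList p M ∧ Γ.map Prod.snd = iidList w M' ∧
      prob Γ {x | ¬ ∀ c, counts x.2 c ≤ counts x.1 c / 2} ≤
        prob (poissonLaw r) {n | M < n} + prob (poissonLaw r') {n | n < M'} + ∑ c, δ c := by
  choose γ hγ1 hγ2 hγ using h
  obtain ⟨J, hJ1, hJ2, hJ3, -⟩ := exists_poissonized p r M
  obtain ⟨J', hJ1', hJ2', -, hJ3'⟩ := exists_poissonized w r' M'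
  set π := (piLaw γ).map fun f => ((fun c => (f c).1), fun c => (f c).2) with hπ
  have hπ1 : π.map Prod.fst = J.map Prod.snd := by
    rw [hJ2, hπ, PMF.map_comp]
    simp only [← hγ1]
    exact piLaw_map γ Prod.fst
  have hπ2 : π.map Prod.snd = J'.map Prod.snd := by
    rw [hJ2', hπ, PMF.map_comp]
    simp only [← hγ2]
    exact piLaw_map γ Prod.snd
  obtain ⟨Γ, hΓ1, hΓ2, hΓ⟩ := exists_gluing J J' π hπ1 hπ2
  refine ⟨Γ.map fun x => (x.1.1, x.2.1), ?_, ?_, ?_⟩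
  · rw [PMF.map_comp, ← hJ1, ← hΓ1, PMF.map_comp]; rfl
  · rw [PMF.map_comp, ← hJ1', ← hΓ2, PMF.map_comp]; rfl
  · rw [prob_map]
    -- Off the three bad events, each fixed-size target count is at most its Poisson count, which is
    -- at most half the other Poisson count, hence at most half the source count.
    calc _ ≤ prob Γ ((Prod.fst ⁻¹' {x | ¬ x.2 ≤ counts x.1} ∪
            Prod.snd ⁻¹' {x | ¬ counts x.1 ≤ x.2}) ∪
            (fun x => (x.1.2, x.2.2)) ⁻¹' {y | ∃ c, y.1 c / 2 < y.2 c}) := by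
          refine prob_mono _ fun x hx => ?_
          by_contra hcon
          simp only [Set.mem_union, Set.mem_preimage, Set.mem_ofPred_eq, not_or, not_not,
            not_exists, not_lt] at hcon hx
          exact hx fun c => (hcon.1.2 c).trans
            ((hcon.2 c).trans (Nat.div_le_div_right (hcon.1.1 c)))
      _ ≤ _ := by
          refine (prob_union_le _ _ _).trans (add_le_add ((prob_union_le _ _ _).trans
            (add_le_add ?_ ?_)) ?_)
          · rw [← prob_map, hΓ1]; exact hJ3
          · rw [← prob_map, hΓ2]; exact hJ3'
          · rw [← prob_map, hΓ, hπ, prob_map]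
            exact (prob_piLaw_exists_le γ fun _ => {z | z.1 / 2 < z.2}).trans
              (Finset.sum_le_sum fun c _ => hγ c)

/-- The pairs found among `M` samples from `p` can be coupled to contain a sample of suitable size
from the distribution proportional to `p²`. -/
theorem exists_pairs_coupling (p w : PMF S) {M : ℕ} {κ P : ℝ} (hM : 2 ≤ M)
    (hκ : 100 * Real.log M ≤ κ) (hp : ∀ c, (p c).toReal ≤ P) (hP : ∃ c, (p c).toReal = P)
    (hMP : 10 * κ ^ 2 ≤ M * P)
    (hw : ∀ c, (w c).toReal * ∑ d, (p d).toReal ^ 2 = (p c).toReal ^ 2) :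
    ∃ Γ : PMF (List S × List S), Γ.map Prod.fst = iidList p M ∧
      Γ.map Prod.snd = iidList w ⌈(M : ℝ) / (32 * κ) * ((∑ d, (p d).toReal ^ 2) / P)⌉₊ ∧
      prob Γ {x | ¬ ∀ c, counts x.2 c ≤ counts x.1 c / 2} ≤
        ENNReal.ofReal (Real.exp (-(1 / 32) * κ)) := by
  set Q := ∑ d, (p d).toReal ^ 2 with hQ
  have hM2 : (2 : ℝ) ≤ M := by exact_mod_cast hM
  have hlog2 : Real.log 2 ≤ Real.log M := Real.log_le_log two_pos hM2
  have hκ60 : 60 ≤ κ := by linarith [Real.log_two_gt_d9]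
  have hP1 : P ≤ 1 := by
    obtain ⟨c, rfl⟩ := hP
    exact ENNReal.toReal_le_of_le_ofReal zero_le_one (by simpa using p.coe_le_one c)
  have hP0 : 0 < P := by
    by_contra h
    nlinarith [sq_nonneg κ]
  have hQP : Q ≤ P := by
    calc Q ≤ ∑ d, (p d).toReal * P := Finset.sum_le_sum fun d _ => by
          rw [sq]; exact mul_le_mul_of_nonneg_left (hp d) ENNReal.toReal_nonneg
      _ = P := by rw [← Finset.sum_mul, sum_toReal_eq_one, one_mul]
  have hPQ : P ^ 2 ≤ Q := by
    obtain ⟨c, rfl⟩ := hP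
    exact Finset.single_le_sum (f := fun d => (p d).toReal ^ 2) (fun d _ => sq_nonneg _)
      (Finset.mem_univ c)
  have hQ0 : 0 < Q := lt_of_lt_of_le (by positivity) hPQ
  set x := (M : ℝ) / (32 * κ) * (Q / P) with hx
  set M' := ⌈x⌉₊ with hM'
  have hxlow : 10 * κ / 32 ≤ x := by
    have h1 : P ≤ Q / P := by rw [le_div_iff₀ hP0]; nlinarith
    calc 10 * κ / 32 = 10 * κ ^ 2 / (32 * κ) := by field_simp
      _ ≤ M * P / (32 * κ) := by gcongr
      _ = M / (32 * κ) * P := by ring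
      _ ≤ _ := mul_le_mul_of_nonneg_left h1 (by positivity)
  have hM'low : 10 * κ / 32 ≤ M' := hxlow.trans (Nat.le_ceil _)
  -- As x ≥ 10κ/32 > 1, rounding up at most doubles it.
  have hM'up : (M' : ℝ) ≤ 2 * x := by
    have := (Nat.ceil_lt_add_one (show 0 ≤ x by linarith)).le
    linarith
  have hM'M : (M' : ℝ) ≤ M := by
    refine hM'up.trans ?_
    have h1 : Q / P ≤ 1 := (div_le_one hP0).2 hQP
    have h2 : x ≤ M / (32 * κ) * 1 := mul_le_mul_of_nonneg_left h1 (by positivity)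
    have h3 : (M : ℝ) / (32 * κ) ≤ M / 2 := by gcongr; linarith
    linarith
  -- The means M/2 and 2M' leave a factor of two on each side, so the Poisson sizes fall on the
  -- right side of M and M' up to e^{-κ/16} each.
  obtain ⟨Γ, hΓ1, hΓ2, hΓ⟩ := exists_sample_coupling p w (M / 2) (2 * M') M M'
    (fun c => ENNReal.ofReal ((2 * (M / 2 * (p c).toReal) + 2 * M' * (w c).toReal) *
      Real.exp (-κ / 16))) (by
    intro c
    have hwc : 2 * M' * (w c).toReal ≤ M * (p c).toReal ^ 2 / (8 * κ * P) := by
      have hwc' : (w c).toReal = (p c).toReal ^ 2 / Q := by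
        rw [eq_div_iff hQ0.ne', hw]
      calc 2 * M' * (w c).toReal ≤ 2 * (2 * x) * (w c).toReal :=
            mul_le_mul_of_nonneg_right (by linarith) ENNReal.toReal_nonneg
        _ = _ := by rw [hwc', hx]; field_simp; ring
    refine exists_poissonLaw_coupling (a := M / 2 * (p c).toNNReal)
      (b := 2 * M' * (w c).toNNReal) hκ60 ?_ ?_
    · refine hwc.trans ?_
      change _ ≤ (M / 2 * (p c).toReal) / (4 * κ)
      rw [div_le_div_iff₀ (by positivity) (by positivity)]
      have h1 : (p c).toReal ^ 2 ≤ (p c).toReal * P := by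
        rw [sq]; exact mul_le_mul_of_nonneg_left (hp c) ENNReal.toReal_nonneg
      have h2 : (0 : ℝ) ≤ M * (4 * κ) := by positivity
      nlinarith [mul_le_mul_of_nonneg_left h1 h2]
    · refine hwc.trans ?_
      change _ ≤ (M / 2 * (p c).toReal) ^ 2 / (20 * κ ^ 3)
      rw [div_le_div_iff₀ (by positivity) (by positivity)]
      have h2 : (0 : ℝ) ≤ M * (p c).toReal ^ 2 * κ := by positivity
      nlinarith [mul_le_mul_of_nonneg_left hMP h2])
  refine ⟨Γ, hΓ1, hΓ2, hΓ.trans ?_⟩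
  have hexp := Real.exp_pos (-κ / 16)
  have e1 : prob (poissonLaw (M / 2)) {n | M < n} ≤ ENNReal.ofReal (Real.exp (-κ / 16)) := by
    refine (prob_poissonLaw_upper _ (M : ℝ) _ fun n hn => by exact_mod_cast (Nat.le_of_lt hn)).trans
      (ENNReal.ofReal_le_ofReal (Real.exp_le_exp.2 ?_))
    push_cast
    have h1 : κ ≤ M := by nlinarith
    nlinarith [Real.log_two_gt_d9]
  have e2 : prob (poissonLaw (2 * M')) {n | n < M'} ≤ ENNReal.ofReal (Real.exp (-κ / 16)) := by
    refine (prob_poissonLaw_lower _ _ fun n (hn : n < M') => ?_).trans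
      (ENNReal.ofReal_le_ofReal (Real.exp_le_exp.2 ?_))
    · push_cast
      have : (n : ℝ) ≤ M' := by exact_mod_cast hn.le
      linarith
    · push_cast
      linarith
  have e3 : ∑ c, ENNReal.ofReal ((2 * (M / 2 * (p c).toReal) + 2 * M' * (w c).toReal) *
      Real.exp (-κ / 16)) = ENNReal.ofReal ((M + 2 * M') * Real.exp (-κ / 16)) := by
    rw [← ENNReal.ofReal_sum_of_nonneg fun c _ => by positivity, ← Finset.sum_mul,
      Finset.sum_add_distrib, ← Finset.mul_sum, ← Finset.mul_sum, ← Finset.mul_sum,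
      sum_toReal_eq_one, sum_toReal_eq_one]
    congr 2
    ring
  rw [e3]
  refine (add_le_add (add_le_add e1 e2) le_rfl).trans ?_
  rw [← ENNReal.ofReal_add hexp.le hexp.le, ← ENNReal.ofReal_add (by positivity) (by positivity)]
  refine ENNReal.ofReal_le_ofReal ?_
  -- Half of the exponent κ/16 pays for the union bound: 4M ≤ M³ = e^{3 log M}, and 3 · 32 ≤ 100.
  have h4M : 4 * (M : ℝ) ≤ Real.exp (κ / 32) := by
    have h1 : 4 * (M : ℝ) ≤ (M : ℝ) ^ 3 := by nlinarith [mul_le_mul hM2 hM2 (by norm_num) (by positivity)]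
    have h2 : (M : ℝ) = Real.exp (Real.log M) := (Real.exp_log (by positivity)).symm
    calc 4 * (M : ℝ) ≤ (M : ℝ) ^ 3 := h1
      _ = Real.exp (3 * Real.log M) := by
        conv_lhs => rw [h2, ← Real.exp_nat_mul]
        norm_num
      _ ≤ _ := Real.exp_le_exp.2 (by linarith)
  calc _ ≤ 4 * (M : ℝ) * Real.exp (-κ / 16) := by nlinarith
    _ ≤ Real.exp (κ / 32) * Real.exp (-κ / 16) := by gcongr
    _ = _ := by rw [← Real.exp_add]; ring_nf

end SampleCoupling

variable {n : ℕ}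

/-! ### Gaussian masses of sets -/

section Mass

/-- The Gaussian mass of a set. -/
def setMass (s : ℝ) (A : Set (EuclideanSpace ℝ (Fin n))) : ℝ≥0∞ :=
  ∑' x, A.indicator (fun x => ENNReal.ofReal (gaussianMass s x)) x

theorem ofReal_gaussianMass_ne_zero (s : ℝ) (x : EuclideanSpace ℝ (Fin n)) :
    ENNReal.ofReal (gaussianMass s x) ≠ 0 :=
  fun h => absurd (ENNReal.ofReal_eq_zero.mp h) (not_le.mpr (Real.exp_pos _))

theorem setMass_ne_zero (s : ℝ) {A : Set (EuclideanSpace ℝ (Fin n))} (hA : A.Nonempty) :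
    setMass s A ≠ 0 := by
  obtain ⟨x, hx⟩ := hA
  intro h
  have := ENNReal.tsum_eq_zero.1 h x
  rw [Set.indicator_of_mem hx] at this
  exact ofReal_gaussianMass_ne_zero s x this

/-- The shifted lattice `L - t`. -/
def shift (L : Submodule ℤ (EuclideanSpace ℝ (Fin n))) (t : EuclideanSpace ℝ (Fin n)) :
    Set (EuclideanSpace ℝ (Fin n)) := {x | x + t ∈ L}

variable {s : ℝ} (hs : 0 < s) (L : Submodule ℤ (EuclideanSpace ℝ (Fin n)))
  (t : EuclideanSpace ℝ (Fin n))

theorem shift_nonempty : (shift L t).Nonempty := ⟨-t, by simp [shift]⟩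

theorem tsum_lattice (f : EuclideanSpace ℝ (Fin n) → ℝ≥0∞) :
    ∑' y : L, f ((y : EuclideanSpace ℝ (Fin n)) - t) = ∑' x, (shift L t).indicator f x := by
  have hinj : Function.Injective fun y : L => (y : EuclideanSpace ℝ (Fin n)) - t :=
    fun a b h => Subtype.ext (sub_left_injective h)
  have hrange : Set.range (fun y : L => (y : EuclideanSpace ℝ (Fin n)) - t) = shift L t := by
    ext x
    constructor
    · rintro ⟨y, rfl⟩
      simp [shift]
    · intro hx
      exact ⟨⟨x + t, hx⟩, by simp⟩
  rw [← tsum_subtype, ← hrange, tsum_range f hinj]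

variable [DiscreteTopology L]

include hs in
theorem ofReal_latticeMass : ENNReal.ofReal (latticeMass s L t) = setMass s (shift L t) := by
  rw [latticeMass, ENNReal.ofReal_tsum_of_nonneg (f := fun y : L => gaussianMass s ((y : EuclideanSpace ℝ (Fin n)) - t))
    (fun _ => (Real.exp_pos _).le)
    (gaussianMass_summable hs L t)]
  exact tsum_lattice L t fun x => ENNReal.ofReal (gaussianMass s x)

include hs in
theorem setMass_shift_ne_top : setMass s (shift L t) ≠ ∞ := by
  rw [← ofReal_latticeMass hs]
  exact ENNReal.ofReal_ne_top

include hs in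
theorem latticeMass_eq_toReal : latticeMass s L t = (setMass s (shift L t)).toReal := by
  rw [← ofReal_latticeMass hs, ENNReal.toReal_ofReal]
  exact tsum_nonneg fun _ => (Real.exp_pos _).le

theorem discreteGaussian_apply (x : EuclideanSpace ℝ (Fin n)) :
    discreteGaussian hs L t x =
      (shift L t).indicator (fun x => ENNReal.ofReal (gaussianMass s x)) x *
        (setMass s (shift L t))⁻¹ := by
  classical
  rw [discreteGaussian, PMF.map_apply]
  by_cases hx : x ∈ shift L t
  · rw [Set.indicator_of_mem hx, tsum_eq_single ⟨x + t, hx⟩]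
    · rw [if_pos (by simp), PMF.normalize_apply,
        tsum_lattice L t fun x => ENNReal.ofReal (gaussianMass s x)]
      simp [setMass]
    · intro y hy
      rw [if_neg]
      rintro rfl
      exact hy (Subtype.ext (by simp))
  · rw [Set.indicator_of_notMem hx, zero_mul]
    refine ENNReal.tsum_eq_zero.2 fun y => if_neg ?_
    rintro rfl
    exact hx (by simp [shift])

end Mass

/-! ### Cosets of the shifted lattice -/

section Cosets

variable (L : Submodule ℤ (EuclideanSpace ℝ (Fin n))) (t : EuclideanSpace ℝ (Fin n))

theorem mem_twice {x : EuclideanSpace ℝ (Fin n)} : x ∈ twice L ↔ ∃ y ∈ L, y + y = x := by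
  simp [twice, Submodule.mem_map, two_smul]

theorem coset_eq_iff {x y : EuclideanSpace ℝ (Fin n)} :
    coset L x = coset L y ↔ x - y ∈ twice L := Submodule.Quotient.eq _

/-- The cosets of `2L` in `L - t`. -/
@[ext]
structure ShiftCoset : Type where
  /-- The coset as an element of the quotient. -/
  val : EuclideanSpace ℝ (Fin n) ⧸ twice L
  exists_rep : ∃ x ∈ shift L t, coset L x = val

variable {L t}

theorem ShiftCoset.val_injective : Function.Injective (ShiftCoset.val (L := L) (t := t)) :=
  fun _ _ => ShiftCoset.ext

/-- A representative of a coset. -/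
def ShiftCoset.rep (c : ShiftCoset L t) : EuclideanSpace ℝ (Fin n) := c.exists_rep.choose

theorem ShiftCoset.rep_mem (c : ShiftCoset L t) : c.rep ∈ shift L t := c.exists_rep.choose_spec.1

theorem ShiftCoset.coset_rep (c : ShiftCoset L t) : coset L c.rep = c.val := c.exists_rep.choose_spec.2

/-- The vectors of a coset. -/
def ShiftCoset.carrier (c : ShiftCoset L t) : Set (EuclideanSpace ℝ (Fin n)) :=
  {x | coset L x = c.val}

theorem ShiftCoset.rep_mem_carrier (c : ShiftCoset L t) : c.rep ∈ c.carrier := c.coset_rep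

theorem ShiftCoset.mem_carrier_iff {c : ShiftCoset L t} {x : EuclideanSpace ℝ (Fin n)} :
    x ∈ c.carrier ↔ x - c.rep ∈ twice L := by
  rw [← coset_eq_iff, c.coset_rep]; rfl

theorem ShiftCoset.carrier_eq_shift (c : ShiftCoset L t) :
    c.carrier = shift (twice L) (-c.rep) := by
  ext x
  rw [mem_carrier_iff, sub_eq_add_neg]; rfl

theorem mem_shift_of_coset_eq {x y : EuclideanSpace ℝ (Fin n)} (hy : y ∈ shift L t)
    (h : coset L x = coset L y) : x ∈ shift L t := by
  have h1 := twice_le L ((coset_eq_iff L).1 h)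
  have h2 : x + t = (x - y) + (y + t) := by abel
  change x + t ∈ L
  rw [h2]
  exact L.add_mem h1 hy

theorem ShiftCoset.carrier_subset (c : ShiftCoset L t) : c.carrier ⊆ shift L t :=
  fun _ hx => mem_shift_of_coset_eq c.rep_mem (Eq.trans hx c.coset_rep.symm)

variable (L t)

open Classical in
/-- The coset of a vector of `L - t`. -/
def classOf (x : EuclideanSpace ℝ (Fin n)) : ShiftCoset L t :=
  if hx : x ∈ shift L t then ⟨coset L x, x, hx, rfl⟩
  -- Junk value outside L - t, making the map total; the laws classified by it live on L - t.
  else ⟨coset L (-t), -t, by simp [shift], rfl⟩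

variable {L t}

theorem classOf_val {x : EuclideanSpace ℝ (Fin n)} (hx : x ∈ shift L t) :
    (classOf L t x).val = coset L x := by
  simp only [classOf, dif_pos hx]

theorem mem_carrier_classOf {x : EuclideanSpace ℝ (Fin n)} (hx : x ∈ shift L t) :
    x ∈ (classOf L t x).carrier := (classOf_val hx).symm

theorem ShiftCoset.mem_carrier_iff_classOf {c : ShiftCoset L t} {x : EuclideanSpace ℝ (Fin n)}
    (hx : x ∈ shift L t) : x ∈ c.carrier ↔ classOf L t x = c := by
  rw [ShiftCoset.ext_iff, classOf_val hx]; rfl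

variable (L t)

/-- Coordinates mod 2 in a ℤ-basis of L separate the cosets. Finiteness makes the maximum attained
and lets the independent family be indexed by cosets. -/
theorem shiftCoset_finite [DiscreteTopology L] [IsZLattice ℝ L] : Finite (ShiftCoset L t) := by
  classical
  have : Module.Finite ℤ L := ZLattice.module_finite ℝ L
  have : Module.Free ℤ L := ZLattice.module_free ℝ L
  let b := Module.Free.chooseBasis ℤ L
  refine Finite.of_injective (fun c : ShiftCoset L t => fun i =>
    ((b.repr ⟨c.rep + t, c.rep_mem⟩ i : ℤ) : ZMod 2)) fun c d h => ?_
  have hdiv : ∀ i, (2 : ℤ) ∣ b.repr (⟨c.rep + t, c.rep_mem⟩ - ⟨d.rep + t, d.rep_mem⟩) i := by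
    intro i
    have h1 := congrFun h i
    have h2 := ((ZMod.intCast_eq_intCast_iff_dvd_sub _ _ 2).1 h1.symm)
    simpa using h2
  choose f hf using hdiv
  have hsub : (⟨c.rep + t, c.rep_mem⟩ - ⟨d.rep + t, d.rep_mem⟩ : L) =
      (2 : ℤ) • ∑ i, f i • b i := by
    conv_lhs => rw [← b.sum_repr (⟨c.rep + t, c.rep_mem⟩ - ⟨d.rep + t, d.rep_mem⟩)]
    rw [Finset.smul_sum]
    refine Finset.sum_congr rfl fun i _ => ?_
    rw [hf i, mul_smul]
  have hval := congrArg (Subtype.val) hsub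
  refine ShiftCoset.ext ?_
  rw [← c.coset_rep, ← d.coset_rep, coset_eq_iff, mem_twice]
  refine ⟨(∑ i, f i • b i : L), (∑ i, f i • b i : L).2, ?_⟩
  have h3 : c.rep - d.rep = (c.rep + t) - (d.rep + t) := by abel
  rw [h3, ← two_zsmul]
  exact hval.symm

end Cosets

/-! ### Gaussian mixtures -/

section Mixtures

variable {s : ℝ} (hs : 0 < s) {L : Submodule ℤ (EuclideanSpace ℝ (Fin n))}
  [DiscreteTopology L] {t : EuclideanSpace ℝ (Fin n)}

/-- The discrete Gaussian on a coset of `2L` in `L - t`. -/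
def cosetGaussian (c : ShiftCoset L t) : PMF (EuclideanSpace ℝ (Fin n)) :=
  discreteGaussian hs (twice L) (-c.rep)

theorem cosetGaussian_apply (c : ShiftCoset L t) (x : EuclideanSpace ℝ (Fin n)) :
    cosetGaussian hs c x =
      c.carrier.indicator (fun x => ENNReal.ofReal (gaussianMass s x)) x *
        (setMass s c.carrier)⁻¹ := by
  rw [cosetGaussian, discreteGaussian_apply, ← c.carrier_eq_shift]

omit [DiscreteTopology L] in
theorem setMass_carrier_ne_zero (s : ℝ) (c : ShiftCoset L t) : setMass s c.carrier ≠ 0 :=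
  setMass_ne_zero s ⟨_, c.rep_mem_carrier⟩

include hs in
theorem setMass_carrier_ne_top (c : ShiftCoset L t) : setMass s c.carrier ≠ ∞ := by
  rw [c.carrier_eq_shift]
  exact setMass_shift_ne_top hs _ _

theorem mem_support_cosetGaussian {c : ShiftCoset L t} {x : EuclideanSpace ℝ (Fin n)}
    (hx : x ∈ (cosetGaussian hs c).support) : coset L x = c.val := by
  by_contra h
  have h' : x ∉ c.carrier := h
  exact hx (by rw [cosetGaussian_apply, Set.indicator_of_notMem h', zero_mul])

theorem discreteGaussian_eq_cosetGaussian {x : EuclideanSpace ℝ (Fin n)} (hx : x ∈ shift L t) :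
    discreteGaussian hs (twice L) (-x) = cosetGaussian hs (classOf L t x) := by
  have h : shift (twice L) (-x) = (classOf L t x).carrier := by
    ext y
    change y + -x ∈ twice L ↔ coset L y = _
    rw [classOf_val hx, coset_eq_iff, sub_eq_add_neg]
  ext y
  rw [discreteGaussian_apply, cosetGaussian_apply, h]

theorem map_coset_of_mem_support {cs : List (ShiftCoset L t)} {l : List (EuclideanSpace ℝ (Fin n))}
    (h : l ∈ (indepList (cs.map (cosetGaussian hs))).support) :
    l.map (coset L) = cs.map ShiftCoset.val := by
  induction cs generalizing l with
  | nil => simp_all [indepList_nil]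
  | cons c cs ih =>
    rw [List.map_cons, indepList_cons, PMF.mem_support_bind_iff] at h
    obtain ⟨x, hx, h⟩ := h
    obtain ⟨l', h', rfl⟩ := (PMF.mem_support_map_iff _ _ _).1 h
    rw [List.map_cons, List.map_cons, ih h', mem_support_cosetGaussian hs hx]

/-- Sampling cosets arbitrarily, and then independently from the Gaussians on them, gives a mixture
of independent Gaussians. -/
theorem isGaussianMixture_bind (η : PMF (List (ShiftCoset L t))) :
    IsGaussianMixture hs L t (η.bind fun cs => indepList (cs.map (cosetGaussian hs))) := by
  constructor
  · intro l hl x hx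
    obtain ⟨cs, -, hl⟩ := (PMF.mem_support_bind_iff _ _ _).1 hl
    have h1 := map_coset_of_mem_support hs hl
    have h2 : coset L x ∈ cs.map ShiftCoset.val := h1 ▸ List.mem_map_of_mem hx
    obtain ⟨c, -, hc⟩ := List.mem_map.1 h2
    exact c.carrier_subset hc.symm
  · intro cs hcs h
    set es := cs.map (classOf L t) with hes
    have hval : cs.map (coset L) = es.map ShiftCoset.val := by
      rw [hes, List.map_map]
      exact List.map_congr_left fun c hc => (classOf_val (hcs c hc)).symm
    have hR : (cs.map fun c => discreteGaussian hs (twice L) (-c)) =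
        es.map (cosetGaussian hs) := by
      rw [hes, List.map_map]
      exact List.map_congr_left fun c hc => discreteGaussian_eq_cosetGaussian hs (hcs c hc)
    set A := {l : List (EuclideanSpace ℝ (Fin n)) | l.map (coset L) = cs.map (coset L)} with hA
    -- The Gaussian on a coset lives on that coset, so the vectors determine the coset list, and
    -- conditioning keeps only the term `es`.
    have key : ∀ l, A.indicator (η.bind fun cs => indepList (cs.map (cosetGaussian hs))) l =
        η es * indepList (es.map (cosetGaussian hs)) l := by
      intro l
      by_cases hl : l ∈ A
      · rw [Set.indicator_of_mem hl, PMF.bind_apply, tsum_eq_single es]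
        intro es' hne
        rw [(PMF.apply_eq_zero_iff (indepList (es'.map (cosetGaussian hs))) l).2, mul_zero]
        intro hl'
        refine hne (List.map_injective_iff.2 ShiftCoset.val_injective ?_)
        rw [← map_coset_of_mem_support hs hl', ← hval]
        exact hl
      · rw [Set.indicator_of_notMem hl,
          (PMF.apply_eq_zero_iff (indepList (es.map (cosetGaussian hs))) l).2, mul_zero]
        intro hl'
        exact hl ((map_coset_of_mem_support hs hl').trans hval.symm)
    have hη : η es ≠ 0 := by
      obtain ⟨l, hl, hl'⟩ := h
      intro h0
      have := key l
      rw [Set.indicator_of_mem hl, h0, zero_mul] at this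
      exact hl' this
    rw [hR]
    ext l
    rw [PMF.filter_apply, key, tsum_congr key, ENNReal.tsum_mul_left, PMF.tsum_coe, mul_one, mul_right_comm,
      ENNReal.mul_inv_cancel hη (η.apply_ne_top _), one_mul]

omit [DiscreteTopology L] in
/-- The coset distribution of a law that is Gaussian on each coset. -/
theorem map_classOf_apply {μ : PMF (EuclideanSpace ℝ (Fin n))} {h : ShiftCoset L t → ℝ≥0∞}
    (hμ : ∀ x, μ x = (shift L t).indicator
      (fun x => ENNReal.ofReal (gaussianMass s x) * h (classOf L t x)) x) (c : ShiftCoset L t) :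
    μ.map (classOf L t) c = setMass s c.carrier * h c := by
  classical
  rw [PMF.map_apply, setMass, ← ENNReal.tsum_mul_right]
  refine tsum_congr fun x => ?_
  rw [hμ]
  by_cases hx : x ∈ shift L t
  · rw [Set.indicator_of_mem hx]
    by_cases hc : classOf L t x = c
    · rw [if_pos hc.symm, Set.indicator_of_mem ((ShiftCoset.mem_carrier_iff_classOf hx).2 hc), hc]
    · rw [if_neg (Ne.symm hc), Set.indicator_of_notMem
        (mt (ShiftCoset.mem_carrier_iff_classOf hx).1 hc), zero_mul]
  · rw [Set.indicator_of_notMem hx, Set.indicator_of_notMem (mt (fun h => c.carrier_subset h) hx), zero_mul,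
      ite_self]

/-- A density ρ_s(x) times a function of the class of x is, inside each class, proportional to ρ_s.
This is the criterion for being a mixture of coset Gaussians. -/
theorem eq_bind_cosetGaussian {μ : PMF (EuclideanSpace ℝ (Fin n))} {h : ShiftCoset L t → ℝ≥0∞}
    (hμ : ∀ x, μ x = (shift L t).indicator
      (fun x => ENNReal.ofReal (gaussianMass s x) * h (classOf L t x)) x) :
    μ = (μ.map (classOf L t)).bind (cosetGaussian hs) := by
  ext x
  rw [PMF.bind_apply, hμ]
  simp only [map_classOf_apply hμ, cosetGaussian_apply]
  by_cases hx : x ∈ shift L t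
  · rw [Set.indicator_of_mem hx, tsum_eq_single (classOf L t x),
      Set.indicator_of_mem (mem_carrier_classOf hx)]
    · have h1 := ENNReal.mul_inv_cancel (setMass_carrier_ne_zero s (classOf L t x))
        (setMass_carrier_ne_top hs _)
      calc _ = ENNReal.ofReal (gaussianMass s x) * h (classOf L t x) *
            (setMass s (classOf L t x).carrier * (setMass s (classOf L t x).carrier)⁻¹) := by
            rw [h1, mul_one]
        _ = _ := by ring
    · intro c hc
      rw [Set.indicator_of_notMem (mt (ShiftCoset.mem_carrier_iff_classOf hx).1 hc.symm), zero_mul,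
        mul_zero]
  · rw [Set.indicator_of_notMem hx]
    refine (ENNReal.tsum_eq_zero.2 fun c => ?_).symm
    rw [Set.indicator_of_notMem (mt (fun h => c.carrier_subset h) hx), zero_mul, mul_zero]

theorem discreteGaussian_apply_eq (x : EuclideanSpace ℝ (Fin n)) :
    discreteGaussian hs L t x = (shift L t).indicator
      (fun x => ENNReal.ofReal (gaussianMass s x) * (setMass s (shift L t))⁻¹) x := by
  rw [discreteGaussian_apply]
  by_cases hx : x ∈ shift L t
  · rw [Set.indicator_of_mem hx, Set.indicator_of_mem hx]
  · rw [Set.indicator_of_notMem hx, Set.indicator_of_notMem hx, zero_mul]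

variable (L t) in
/-- The coset distribution of the discrete Gaussian on `L - t`. -/
def cosetLaw : PMF (ShiftCoset L t) := (discreteGaussian hs L t).map (classOf L t)

theorem cosetLaw_apply (c : ShiftCoset L t) :
    cosetLaw hs L t c = setMass s c.carrier * (setMass s (shift L t))⁻¹ :=
  map_classOf_apply (h := fun _ => (setMass s (shift L t))⁻¹) (discreteGaussian_apply_eq hs) c

theorem discreteGaussian_eq_bind :
    discreteGaussian hs L t = (cosetLaw hs L t).bind (cosetGaussian hs) :=
  eq_bind_cosetGaussian hs (h := fun _ => (setMass s (shift L t))⁻¹) (discreteGaussian_apply_eq hs)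

end Mixtures

/-! ### The average of two Gaussian vectors -/

section Average

theorem gaussianMass_add_mul_sub {s : ℝ} (hs : 0 < s) (z d : EuclideanSpace ℝ (Fin n)) :
    gaussianMass s (z + d) * gaussianMass s (z - d) =
      gaussianMass (s / √2) z * gaussianMass (s / √2) d := by
  have h := parallelogram_law_with_norm ℝ z d
  have h2 : (s / √2) ^ 2 = s ^ 2 / 2 := by rw [div_pow, Real.sq_sqrt zero_le_two]
  simp only [gaussianMass]
  rw [← Real.exp_add, ← Real.exp_add, h2]
  congr 1
  field_simp
  linear_combination (-1 : ℝ) * h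

variable {s : ℝ} (hs : 0 < s) {L : Submodule ℤ (EuclideanSpace ℝ (Fin n))}
  {t : EuclideanSpace ℝ (Fin n)}

/-- The sum 2z of z + d and z - d is congruent to 2 `c.rep` modulo 2L, because z - `c.rep` lies in
L. -/
theorem mem_carrier_sub {c : ShiftCoset L t} {z d : EuclideanSpace ℝ (Fin n)} (hz : z ∈ shift L t)
    (h : z + d ∈ c.carrier) : z - d ∈ c.carrier := by
  rw [ShiftCoset.mem_carrier_iff] at h ⊢
  have h1 : (z + t) - (c.rep + t) ∈ L := L.sub_mem hz c.rep_mem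
  have h2 : (z - d) - c.rep =
      (((z + t) - (c.rep + t)) + ((z + t) - (c.rep + t))) - (z + d - c.rep) := by abel
  rw [h2]
  exact (twice L).sub_mem ((mem_twice L).2 ⟨_, h1, rfl⟩) h

/-- Adding the two memberships gives 2(z - `c.rep`) ∈ 2L, and 2 can be cancelled. So averages of two
vectors of c lie in L - t. -/
theorem mem_shift_of_add_sub {c : ShiftCoset L t} {z d : EuclideanSpace ℝ (Fin n)}
    (h : z + d ∈ c.carrier) (h' : z - d ∈ c.carrier) : z ∈ shift L t := by
  rw [ShiftCoset.mem_carrier_iff, mem_twice] at h h'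
  obtain ⟨a, ha, hae⟩ := h
  obtain ⟨b, hb, hbe⟩ := h'
  have h2 : (2 : ℝ) • (z - c.rep) = (2 : ℝ) • (a + b) := by
    rw [two_smul, two_smul]
    calc z - c.rep + (z - c.rep) = (z + d - c.rep) + (z - d - c.rep) := by abel
      _ = _ := by rw [← hae, ← hbe]; abel
  have h3 : z - c.rep = a + b := smul_right_injective _ (two_ne_zero (α := ℝ)) h2
  have h4 : z + t = (a + b) + (c.rep + t) := by rw [← h3]; abel
  change z + t ∈ L
  rw [h4]
  exact L.add_mem (L.add_mem ha hb) c.rep_mem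

/-- The set of `d` for which `z + d` lies in the coset `c`. -/
def ShiftCoset.translate (c : ShiftCoset L t) (z : EuclideanSpace ℝ (Fin n)) :
    Set (EuclideanSpace ℝ (Fin n)) := {d | z + d ∈ c.carrier}

theorem ShiftCoset.translate_rep_classOf (c : ShiftCoset L t) {z : EuclideanSpace ℝ (Fin n)}
    (hz : z ∈ shift L t) : c.translate (classOf L t z).rep = c.translate z := by
  ext d
  have h : coset L ((classOf L t z).rep + d) = coset L (z + d) := by
    rw [coset_eq_iff, add_sub_add_right_eq_sub, ← coset_eq_iff, ShiftCoset.coset_rep,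
      classOf_val hz]
  change coset L _ = _ ↔ coset L _ = _
  rw [h]

/-- For z in L - t, a vector d lies in L exactly when z + d lies in L - t, hence in exactly one
coset: the translates partition L. -/
theorem sum_setMass_translate [Fintype (ShiftCoset L t)] (s : ℝ) {z : EuclideanSpace ℝ (Fin n)}
    (hz : z ∈ shift L t) : ∑ c : ShiftCoset L t, setMass s (c.translate z) = setMass s (shift L 0) := by
  classical
  have hmem : ∀ d, z + d ∈ shift L t ↔ d ∈ shift L 0 := by
    intro d
    change z + d + t ∈ L ↔ d + 0 ∈ L
    rw [show z + d + t = (z + t) + (d + 0) by abel]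
    exact L.add_mem_iff_right hz
  simp only [setMass]
  rw [← tsum_fintype (L := .unconditional _), ENNReal.tsum_comm]
  refine tsum_congr fun d => ?_
  by_cases hd : d ∈ shift L 0
  · have hd' := (hmem d).2 hd
    rw [Set.indicator_of_mem hd, tsum_eq_single (classOf L t (z + d)), Set.indicator_of_mem]
    · exact mem_carrier_classOf hd'
    · intro c hc
      refine Set.indicator_of_notMem (fun h => hc ?_) _
      exact ((ShiftCoset.mem_carrier_iff_classOf hd').1 h).symm
  · rw [Set.indicator_of_notMem hd]
    refine ENNReal.tsum_eq_zero.2 fun c => Set.indicator_of_notMem (fun h => hd ?_) _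
    exact (hmem d).1 (c.carrier_subset h)

variable [DiscreteTopology L]

/-- The law of the average of two independent Gaussians on the same coset of `2L`. -/
def averageLaw (c : ShiftCoset L t) : PMF (EuclideanSpace ℝ (Fin n)) :=
  (cosetGaussian hs c).bind fun x => (cosetGaussian hs c).map fun y => (1 / 2 : ℝ) • (x + y)

/-- Substituting x = z + d, y = z - d and applying the parallelogram law splits off ρ_{s/√2}(z). The
remaining sum runs over the d with z + d ∈ c, a set that depends only on z mod 2L. -/
theorem averageLaw_apply (c : ShiftCoset L t) (z : EuclideanSpace ℝ (Fin n)) :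
    averageLaw hs c z = (shift L t).indicator
      (fun z => ENNReal.ofReal (gaussianMass (s / √2) z) *
        (setMass (s / √2) (c.translate (classOf L t z).rep) * ((setMass s c.carrier) ^ 2)⁻¹)) z := by
  classical
  have h1 : averageLaw hs c z = ∑' d, cosetGaussian hs c (z + d) * cosetGaussian hs c (z - d) := by
    rw [averageLaw, PMF.bind_apply, ← (Equiv.addLeft z).tsum_eq]
    refine tsum_congr fun d => ?_
    rw [Equiv.coe_addLeft, PMF.map_apply, tsum_eq_single (z - d), if_pos]
    · rw [show z + d + (z - d) = (2 : ℝ) • z by rw [two_smul]; abel, smul_smul]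
      norm_num
    · intro y hy
      rw [if_neg]
      intro hzy
      refine hy ?_
      have : (2 : ℝ) • z = z + d + y := by
        conv_lhs => rw [hzy]
        rw [smul_smul]
        norm_num
      rw [two_smul] at this
      calc y = (z + d + y) - z - d := by abel
        _ = _ := by rw [← this]; abel
  rw [h1]
  by_cases hz : z ∈ shift L t
  · rw [Set.indicator_of_mem hz, c.translate_rep_classOf hz, setMass, ← ENNReal.tsum_mul_right,
      ← ENNReal.tsum_mul_left]
    refine tsum_congr fun d => ?_
    rw [cosetGaussian_apply, cosetGaussian_apply]
    by_cases hd : z + d ∈ c.carrier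
    · have hd' : d ∈ c.translate z := hd
      rw [Set.indicator_of_mem hd, Set.indicator_of_mem (mem_carrier_sub hz hd),
        Set.indicator_of_mem hd', sq, ENNReal.mul_inv (.inl (setMass_carrier_ne_zero s c))
          (.inl (setMass_carrier_ne_top hs c)), ← mul_assoc (ENNReal.ofReal _),
        ← ENNReal.ofReal_mul (p := gaussianMass (s / √2) z) (Real.exp_pos _).le,
        ← gaussianMass_add_mul_sub hs, ENNReal.ofReal_mul (p := gaussianMass s (z + d))
          (Real.exp_pos _).le]
      ring
    · have hd' : d ∉ c.translate z := hd
      rw [Set.indicator_of_notMem hd, Set.indicator_of_notMem hd', zero_mul, zero_mul, zero_mul,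
        mul_zero]
  · rw [Set.indicator_of_notMem hz]
    refine ENNReal.tsum_eq_zero.2 fun d => ?_
    rw [cosetGaussian_apply, cosetGaussian_apply]
    by_cases hd : z + d ∈ c.carrier
    · have hd' : z - d ∉ c.carrier := fun hd' => hz (mem_shift_of_add_sub hd hd')
      rw [Set.indicator_of_notMem hd', zero_mul, mul_zero]
    · rw [Set.indicator_of_notMem hd, zero_mul, zero_mul]

theorem averageLaw_eq_bind (c : ShiftCoset L t) :
    averageLaw hs c =
      ((averageLaw hs c).map (classOf L t)).bind (cosetGaussian (div_sqrt_two_pos hs)) :=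
  eq_bind_cosetGaussian (div_sqrt_two_pos hs) (h := fun e => setMass (s / √2) (c.translate e.rep) *
    ((setMass s c.carrier) ^ 2)⁻¹) (averageLaw_apply hs c)

variable [Fintype (ShiftCoset L t)]

variable (L t) in
omit [DiscreteTopology L] in
theorem sum_sq_setMass_ne_zero (s : ℝ) : ∑ c : ShiftCoset L t, setMass s c.carrier ^ 2 ≠ 0 := by
  intro h
  have := (Finset.sum_eq_zero_iff.1 h) (classOf L t (-t)) (Finset.mem_univ _)
  exact setMass_carrier_ne_zero s _ (pow_eq_zero_iff two_ne_zero |>.1 this)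

include hs in
variable (L t) in
theorem sum_sq_setMass_ne_top : ∑ c : ShiftCoset L t, setMass s c.carrier ^ 2 ≠ ∞ :=
  ENNReal.sum_ne_top.2 fun c _ => ENNReal.pow_ne_top (setMass_carrier_ne_top hs c)

variable (L t) in
/-- The law on cosets proportional to the square of the Gaussian mass. -/
def squareLaw : PMF (ShiftCoset L t) :=
  PMF.ofFintype (fun c => setMass s c.carrier ^ 2 *
    (∑ d : ShiftCoset L t, setMass s d.carrier ^ 2)⁻¹) (by
      rw [← Finset.sum_mul]
      exact ENNReal.mul_inv_cancel (sum_sq_setMass_ne_zero L t s) (sum_sq_setMass_ne_top hs L t))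

/-- The weight ρ_s(c)² cancels the normalization of the two Gaussians on c, and the remaining masses
of the translates add up to ρ_{s/√2}(L). -/
theorem squareLaw_bind_apply (z : EuclideanSpace ℝ (Fin n)) :
    (squareLaw hs L t).bind (averageLaw hs) z = (shift L t).indicator
      (fun z => ENNReal.ofReal (gaussianMass (s / √2) z)) z *
        (setMass (s / √2) (shift L 0) * (∑ d : ShiftCoset L t, setMass s d.carrier ^ 2)⁻¹) := by
  rw [PMF.bind_apply, tsum_fintype]
  by_cases hz : z ∈ shift L t
  · rw [Set.indicator_of_mem hz, ← sum_setMass_translate (t := t) _ hz, Finset.sum_mul,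
      Finset.mul_sum]
    refine Finset.sum_congr rfl fun c _ => ?_
    rw [averageLaw_apply, Set.indicator_of_mem hz, c.translate_rep_classOf hz, squareLaw,
      PMF.ofFintype_apply]
    have h0 : setMass s c.carrier ^ 2 ≠ 0 := pow_ne_zero _ (setMass_carrier_ne_zero s c)
    have h1 : setMass s c.carrier ^ 2 ≠ ∞ := ENNReal.pow_ne_top (setMass_carrier_ne_top hs c)
    have h2 := ENNReal.mul_inv_cancel h0 h1
    refine Eq.trans ?_ (mul_one _)
    rw [← h2]
    ring
  · rw [Set.indicator_of_notMem hz, zero_mul]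
    refine Finset.sum_eq_zero fun c _ => ?_
    rw [averageLaw_apply, Set.indicator_of_notMem hz, mul_zero]

include hs in
variable (L t) in
/-- `∑_c ρ_s(c)² = ρ_{s/√2}(L - t) ρ_{s/√2}(L)`, the sum being over the cosets of `2L` in `L - t`. -/
theorem sum_sq_setMass : ∑ c : ShiftCoset L t, setMass s c.carrier ^ 2 =
    setMass (s / √2) (shift L t) * setMass (s / √2) (shift L 0) := by
  -- The identity is read off from the total mass 1 of this law, whose density was just computed.
  have h := ((squareLaw hs L t).bind (averageLaw hs)).tsum_coe
  simp only [squareLaw_bind_apply] at h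
  rw [ENNReal.tsum_mul_right, ← mul_assoc, ← div_eq_mul_inv] at h
  exact ((ENNReal.div_eq_one_iff (sum_sq_setMass_ne_zero L t s)
    (sum_sq_setMass_ne_top hs L t)).1 h).symm

variable (L t) in
theorem squareLaw_bind : (squareLaw hs L t).bind (averageLaw hs) =
    discreteGaussian (div_sqrt_two_pos hs) L t := by
  ext z
  rw [squareLaw_bind_apply, discreteGaussian_apply, sum_sq_setMass hs L t,
    ENNReal.mul_inv (.inl (setMass_ne_zero _ (shift_nonempty L t)))
      (.inl (setMass_shift_ne_top (div_sqrt_two_pos hs) L t)),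
    mul_left_comm (setMass (s / √2) (shift L 0)),
    ENNReal.mul_inv_cancel (setMass_ne_zero _ (shift_nonempty L 0))
      (setMass_shift_ne_top (div_sqrt_two_pos hs) L 0), mul_one]

end Average

/-! ### The law of the output of pair-and-average -/

section PairLaw

variable {s : ℝ} (hs : 0 < s) {L : Submodule ℤ (EuclideanSpace ℝ (Fin n))}
  [DiscreteTopology L] {t : EuclideanSpace ℝ (Fin n)}

open Classical in
-- The position of the partner is decided by the cosets alone, so the partner is a fresh Gaussian on
-- c, independent of the vectors left over.
theorem indepList_map_find_eraseP {c : ShiftCoset L t} {cs : List (ShiftCoset L t)} (h : c ∈ cs)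
    {x : EuclideanSpace ℝ (Fin n)} (hx : coset L x = c.val) :
    (indepList (cs.map (cosetGaussian hs))).map
      (fun xs => (xs.find? (fun y => decide (coset L y = coset L x)),
        xs.eraseP (fun y => decide (coset L y = coset L x)))) =
    (cosetGaussian hs c).bind fun y =>
      (indepList ((cs.erase c).map (cosetGaussian hs))).map fun l => (some y, l) := by
  induction cs with
  | nil => simp at h
  | cons a cs ih =>
    rw [List.map_cons, indepList_cons, PMF.map_bind]
    by_cases ha : a = c
    · subst ha
      rw [List.erase_cons_head]
      refine bind_congr_support fun y hy => ?_
      have hy' := mem_support_cosetGaussian hs hy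
      rw [PMF.map_comp]
      congr 1
      funext xs
      simp [Function.comp, hy', hx]
    · rw [List.erase_cons_tail (by simpa using ha), List.map_cons]
      have hstep : ∀ y ∈ (cosetGaussian hs a).support,
          ((indepList (cs.map (cosetGaussian hs))).map (List.cons y)).map
            (fun xs => (xs.find? (fun y => decide (coset L y = coset L x)),
              xs.eraseP (fun y => decide (coset L y = coset L x)))) =
          (cosetGaussian hs c).bind fun y' => (indepList ((cs.erase c).map (cosetGaussian hs))).map
            fun l => (some y', y :: l) := by
        intro y hy
        have hy' : coset L y ≠ coset L x := by
          rw [mem_support_cosetGaussian hs hy, hx]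
          exact fun h => ha (ShiftCoset.val_injective h)
        have h1 := congrArg (PMF.map (Prod.map id (List.cons y)))
          (ih ((List.mem_cons.1 h).resolve_left (Ne.symm ha)))
        rw [PMF.map_bind, PMF.map_comp] at h1
        rw [PMF.map_comp]
        refine Eq.trans ?_ (h1.trans ?_)
        · congr 1
          funext xs
          simp [Function.comp, hy']
        · simp only [PMF.map_comp]; rfl
      rw [bind_congr_support hstep, PMF.bind_comm]
      congr 1
      funext y'
      simp only [indepList_cons, PMF.map_bind, PMF.map_comp]
      rfl

/-- Pairing and averaging vectors with given cosets: each pair contributes an independent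
average. -/
theorem map_pairAndAverage (cs : List (ShiftCoset L t)) :
    (indepList (cs.map (cosetGaussian hs))).map (pairAndAverage L) =
      indepList ((pairs cs).map (averageLaw hs)) := by
  classical
  induction cs using pairs.induct with
  | case1 =>
    simp [pairs, indepList_nil, PMF.pure_map, pairAndAverage]
  | case2 c cs h ih =>
    rw [pairs, if_pos h, List.map_cons, List.map_cons, indepList_cons, indepList_cons, PMF.map_bind,
      averageLaw, PMF.bind_bind]
    refine bind_congr_support fun x hx => ?_
    have h1 := congrArg (PMF.map fun z : Option (EuclideanSpace ℝ (Fin n)) × _ =>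
      (1 / 2 : ℝ) • (x + z.1.getD 0) :: pairAndAverage L z.2)
      (indepList_map_find_eraseP hs h (mem_support_cosetGaussian hs hx))
    rw [PMF.map_comp, PMF.map_bind] at h1
    rw [PMF.map_comp, PMF.bind_map]
    refine Eq.trans ?_ (h1.trans ?_)
    · rw [← PMF.bind_pure_comp, ← PMF.bind_pure_comp]
      refine bind_congr_support fun xs hxs => ?_
      have h2 := map_coset_of_mem_support hs hxs
      have h3 : coset L x ∈ xs.map (coset L) := by
        rw [h2, mem_support_cosetGaussian hs hx]
        exact List.mem_map_of_mem h
      obtain ⟨y, hy, hyx⟩ := List.mem_map.1 h3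
      have h4 : (xs.find? fun y => decide (coset L y = coset L x)).isSome :=
        List.find?_isSome.2 ⟨y, hy, by simpa using hyx⟩
      obtain ⟨y', hy'⟩ := Option.isSome_iff_exists.1 h4
      simp only [Function.comp]
      rw [pairAndAverage, hy']
      rfl
    · congr 1
      funext y
      rw [Function.comp, ← ih, PMF.map_comp, PMF.map_comp]
      rfl
  | case3 c cs h ih =>
    rw [pairs, if_neg h, ← ih, List.map_cons, indepList_cons, PMF.map_bind,
      ← PMF.bind_const (cosetGaussian hs c) (PMF.map (pairAndAverage L) _)]
    refine bind_congr_support fun x hx => ?_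
    rw [PMF.map_comp, ← PMF.bind_pure_comp, ← PMF.bind_pure_comp]
    refine bind_congr_support fun xs hxs => ?_
    have h2 := map_coset_of_mem_support hs hxs
    have h3 : xs.find? (fun y => decide (coset L y = coset L x)) = none := by
      rw [List.find?_eq_none]
      intro y hy hyx
      have h4 : coset L y ∈ cs.map ShiftCoset.val := h2 ▸ List.mem_map_of_mem hy
      obtain ⟨d, hd, hdy⟩ := List.mem_map.1 h4
      have h5 : d = c := by
        refine ShiftCoset.val_injective ?_
        rw [hdy, ← mem_support_cosetGaussian hs hx]
        simpa using hyx
      exact h (h5 ▸ hd)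
    simp only [Function.comp]
    rw [pairAndAverage, h3]

variable (L t) in
theorem pairAndAverageGaussian_eq (M : ℕ) :
    pairAndAverageGaussian hs L t M = (iidList (cosetLaw hs L t) M).bind fun cs =>
      indepList ((pairs cs).map (averageLaw hs)) := by
  rw [pairAndAverageGaussian, discreteGaussian_eq_bind, iidList_bind, PMF.map_bind]
  simp only [map_pairAndAverage]

/-- Mixtures of lists of averages are mixtures of independent Gaussians. -/
theorem isGaussianMixture_averages {ι : Type} (γ : PMF ι) (f : ι → List (ShiftCoset L t)) :
    IsGaussianMixture (div_sqrt_two_pos hs) L t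
      (γ.bind fun i => indepList ((f i).map (averageLaw hs))) := by
  have h : (γ.bind fun i => indepList ((f i).map (averageLaw hs))) =
      (γ.bind fun i => indepList ((f i).map fun c => (averageLaw hs c).map (classOf L t))).bind
        fun es => indepList (es.map (cosetGaussian (div_sqrt_two_pos hs))) := by
    rw [PMF.bind_bind]
    congr 1
    funext i
    rw [← indepList_bind]
    simp only [← averageLaw_eq_bind]
  rw [h]
  exact isGaussianMixture_bind _ _

/-- The same kernel acts on both class lists, so containment of multisets for each i passes to the
output cosets as domination, and mixing over i preserves it. -/
theorem mixtureDominates_averages {ι : Type} (γ : PMF ι) (f g : ι → List (ShiftCoset L t))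
    (h : ∀ i, (g i).Subperm (f i)) :
    MixtureDominates L (γ.bind fun i => indepList ((f i).map (averageLaw hs)))
      (γ.bind fun i => indepList ((g i).map (averageLaw hs))) := by
  rw [MixtureDominates, cosetDist, cosetDist, PMF.map_bind, PMF.map_bind]
  refine Dominates.bind fun i => ?_
  rw [map_indepList, map_indepList]
  obtain ⟨l, hl, hsub⟩ := h i
  exact dominates_indepList_of_subperm ⟨_, (hl.map _).map _, (hsub.map _).map _⟩

end PairLaw

/-! ### The main theorem -/

section Main

variable {s : ℝ} (hs : 0 < s) (L : Submodule ℤ (EuclideanSpace ℝ (Fin n)))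
  [DiscreteTopology L] (t : EuclideanSpace ℝ (Fin n))

include hs in
-- The class of c - t runs over all cosets as c runs over L, so the supremum over the lattice
-- becomes a supremum over the cosets themselves.
theorem maxCosetMass_eq :
    maxCosetMass s L t = ⨆ c : ShiftCoset L t, (setMass s c.carrier).toReal := by
  have hmem : ∀ c : L, (c : EuclideanSpace ℝ (Fin n)) - t ∈ shift L t := fun c => by
    simp [shift]
  have hsurj : Function.Surjective fun c : L => classOf L t (c - t) := by
    intro e
    refine ⟨⟨e.rep + t, e.rep_mem⟩, ShiftCoset.ext ?_⟩
    rw [classOf_val (hmem _), ← e.coset_rep]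
    simp
  rw [maxCosetMass, ← hsurj.iSup_comp]
  congr 1
  funext c
  rw [latticeMass_eq_toReal hs]
  congr 2
  ext x
  change x + (t - c) ∈ twice L ↔ coset L x = _
  rw [classOf_val (hmem c), coset_eq_iff, show x + (t - c) = x - ((c : EuclideanSpace ℝ (Fin n)) - t) by abel]

theorem subperm_pairs_iff {S : Type} {l l' : List S}
    (h : ∀ c, counts l c ≤ counts l' c / 2) : l.Subperm (pairs l') := by
  classical
  refine List.subperm_ext_iff.2 fun c _ => ?_
  have h1 := h c
  rw [counts, counts, ← count_pairs] at h1
  convert h1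

include hs in
/-- A coupling of the samples turns into domination up to statistical distance. -/
theorem mixtureDominatesUpTo_of_coupling [Fintype (ShiftCoset L t)] {M M' : ℕ} {ε : ℝ} (hε : 0 ≤ ε)
    (Γ : PMF (List (ShiftCoset L t) × List (ShiftCoset L t)))
    (h1 : Γ.map Prod.fst = iidList (cosetLaw hs L t) M)
    (h2 : Γ.map Prod.snd = iidList (squareLaw hs L t) M')
    (h3 : prob Γ {x | ¬ ∀ c, counts x.2 c ≤ counts x.1 c / 2} ≤ ENNReal.ofReal ε) :
    MixtureDominatesUpTo (div_sqrt_two_pos hs) L t ε (pairAndAverageGaussian hs L t M)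
      (iidList (discreteGaussian (div_sqrt_two_pos hs) L t) M') := by
  classical
  set B := {x : List (ShiftCoset L t) × List (ShiftCoset L t) |
    ¬ ∀ c, counts x.2 c ≤ counts x.1 c / 2} with hB
  have hμ : pairAndAverageGaussian hs L t M =
      Γ.bind fun x => indepList ((pairs x.1).map (averageLaw hs)) := by
    rw [pairAndAverageGaussian_eq, ← h1, PMF.bind_map]; rfl
  have hν : iidList (discreteGaussian (div_sqrt_two_pos hs) L t) M' =
      Γ.bind fun x => indepList (x.2.map (averageLaw hs)) := by
    rw [← squareLaw_bind, iidList_bind, ← h2, PMF.bind_map]; rfl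
  rw [hμ, hν]
  -- On the bad event B one class list is replaced by the other, so containment becomes trivial
  -- there. Off B nothing changes, and the distance is at most the probability of B.
  refine ⟨⟨Γ.bind fun x => indepList ((if x ∈ B then pairs x.1 else x.2).map (averageLaw hs)),
    isGaussianMixture_averages hs _ _, statDist_bind_le _ _ _ B ?_ hε h3,
    mixtureDominates_averages hs _ _ _ ?_⟩,
    ⟨Γ.bind fun x => indepList ((if x ∈ B then x.2 else pairs x.1).map (averageLaw hs)),
    isGaussianMixture_averages hs _ _, statDist_bind_le _ _ _ B ?_ hε h3,
    mixtureDominates_averages hs _ _ _ ?_⟩⟩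
  · intro x hx
    rw [if_neg hx]
  · intro x
    split_ifs with hx
    · exact List.Subperm.refl _
    · exact subperm_pairs_iff (not_not.1 hx)
  · intro x hx
    rw [if_neg hx]
  · intro x
    split_ifs with hx
    · exact List.Subperm.refl _
    · exact subperm_pairs_iff (not_not.1 hx)

end Main

end PairAverage

end

theorem theoremB1 :
    ∃ C c : ℝ, 0 < C ∧ 0 < c ∧
      ∀ (n : ℕ) (L : Submodule ℤ (EuclideanSpace ℝ (Fin n))) [DiscreteTopology L]
        [IsZLattice ℝ L] (t : EuclideanSpace ℝ (Fin n)) (s : ℝ) (hs : 0 < s) (M : ℕ) (κ : ℝ),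
        2 ≤ M → C * Real.log M ≤ κ →
        10 * κ ^ 2 * (PairAverage.latticeMass s L t / PairAverage.maxCosetMass s L t) ≤ (M : ℝ) →
        PairAverage.IsGaussianMixture (PairAverage.div_sqrt_two_pos hs) L t
            (PairAverage.pairAndAverageGaussian hs L t M) ∧
          PairAverage.MixtureDominatesUpTo (PairAverage.div_sqrt_two_pos hs) L t
            (Real.exp (-c * κ))
            (PairAverage.pairAndAverageGaussian hs L t M)
            (PairAverage.iidList
              (PairAverage.discreteGaussian (PairAverage.div_sqrt_two_pos hs) L t)
              (PairAverage.outputCount s L t M κ)) := by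
  open PairAverage in
  refine ⟨100, 1 / 32, by norm_num, by norm_num, ?_⟩
  intro n L _ _ t s hs M κ hM hκ hMκ
  refine ⟨?_, ?_⟩
  · rw [pairAndAverageGaussian_eq]
    exact isGaussianMixture_averages hs _ _
  have := shiftCoset_finite L t
  have := Fintype.ofFinite (ShiftCoset L t)
  set T := latticeMass s L t with hT
  set m := maxCosetMass s L t with hm
  have hTr : T = (setMass s (shift L t)).toReal := latticeMass_eq_toReal hs L t
  have hT0 : 0 < T := by
    rw [hTr]
    exact ENNReal.toReal_pos (setMass_ne_zero _ (shift_nonempty L t)) (setMass_shift_ne_top hs L t)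
  have hp : ∀ c, (cosetLaw hs L t c).toReal = (setMass s c.carrier).toReal / T := by
    intro c
    rw [cosetLaw_apply, ENNReal.toReal_mul, ENNReal.toReal_inv, ← hTr, div_eq_mul_inv]
  have hmeq : m = ⨆ c : ShiftCoset L t, (setMass s c.carrier).toReal := maxCosetMass_eq hs L t
  have : Nonempty (ShiftCoset L t) := ⟨classOf L t (-t)⟩
  have hle : ∀ c : ShiftCoset L t, (setMass s c.carrier).toReal ≤ m := by
    intro c
    rw [hmeq]
    exact le_ciSup (f := fun c : ShiftCoset L t => (setMass s c.carrier).toReal)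
      (Set.finite_range _).bddAbove c
  obtain ⟨c₀, hc₀⟩ := exists_eq_ciSup_of_finite (f := fun c : ShiftCoset L t =>
    (setMass s c.carrier).toReal)
  rw [← hmeq] at hc₀
  have hm0 : 0 < m := by
    rw [← hc₀]
    exact ENNReal.toReal_pos (setMass_carrier_ne_zero s c₀) (setMass_carrier_ne_top hs c₀)
  have hZ : ∑ c : ShiftCoset L t, (setMass s c.carrier).toReal ^ 2 =
      latticeMass (s / √2) L t * latticeMass (s / √2) L 0 := by
    rw [latticeMass_eq_toReal (div_sqrt_two_pos hs), latticeMass_eq_toReal (div_sqrt_two_pos hs),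
      ← ENNReal.toReal_mul, ← sum_sq_setMass hs L t, ENNReal.toReal_sum]
    · simp only [ENNReal.toReal_pow]
    · exact fun c _ => ENNReal.pow_ne_top (setMass_carrier_ne_top hs c)
  have hsum : ∑ c, (cosetLaw hs L t c).toReal ^ 2 =
      latticeMass (s / √2) L t * latticeMass (s / √2) L 0 / T ^ 2 := by
    simp only [hp, div_pow]
    rw [← Finset.sum_div, hZ]
  have hZ0 : latticeMass (s / √2) L t * latticeMass (s / √2) L 0 ≠ 0 := by
    rw [← hZ]
    exact (Finset.sum_pos (fun c _ => pow_pos (ENNReal.toReal_pos (setMass_carrier_ne_zero s c)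
      (setMass_carrier_ne_top hs c)) 2) Finset.univ_nonempty).ne'
  -- With P = m/T the largest coset probability, the hypothesis on M reads 10κ² ≤ M P.
  obtain ⟨Γ, h1, h2, h3⟩ := exists_pairs_coupling (cosetLaw hs L t) (squareLaw hs L t)
    (P := m / T) hM hκ
    (fun c => by rw [hp]; exact div_le_div_of_nonneg_right (hle c) hT0.le)
    ⟨c₀, by rw [hp, hc₀]⟩
    (by
      rw [← mul_div_assoc, le_div_iff₀ hT0]
      rwa [← mul_div_assoc, div_le_iff₀ hm0] at hMκ)
    (by
      intro c
      rw [hsum, hp, squareLaw, PMF.ofFintype_apply, ENNReal.toReal_mul, ENNReal.toReal_inv,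
        ENNReal.toReal_sum fun c _ => ENNReal.pow_ne_top (setMass_carrier_ne_top hs c)]
      simp only [ENNReal.toReal_pow]
      rw [hZ]
      generalize latticeMass (s / √2) L t * latticeMass (s / √2) L 0 = Z at hZ0 ⊢
      field_simp)
  -- With Z the product of the two masses at parameter s/√2, ∑ p² = Z/T², and dividing by m/T gives
  -- the ratio Z/(T m).
  have hcount : outputCount s L t M κ =
      ⌈(M : ℝ) / (32 * κ) * ((∑ c, (cosetLaw hs L t c).toReal ^ 2) / (m / T))⌉₊ := by
    rw [outputCount, hsum, ← hT, ← hm]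
    congr 2
    field_simp
  rw [hcount]
  exact mixtureDominatesUpTo_of_coupling hs L t (Real.exp_pos _).le Γ h1 h2 h3
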